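/- Let $M$, $E$, $F$ be smooth manifolds of dimensions $n$, $n+k$, $k$, and let $\pi:E\to M$ be a smooth fiber bundle with typical fiber $F$. Let $$J^1\pi=\{\tau_e : T_{\pi(e)}M\to T_eE \text{ linear} : e\in E,\ \pi_*(e)\circ\tau_e=\mathrm{id}\}$$ be the first jet bundle of $\pi$, and let $$L_\pi E=\{(e_i,e_A)_e : e\in E,\ (e_1,\dots,e_n,e_{n+1},\dots,e_{n+k}) \text{ is a basis of } T_eE,\ \pi_*(e)(e_A)=0\}$$ be the adapted frame bundle, where $1\le i\le n$ and $A$ runs over the last $k$ indices. Adapted coordinates $(x^i,y^A)$ on an open set $U\subseteq E$ are coordinates such that the $x^i$ are pulled back by $\pi$ from coordinates on an open subset of $M$. They induce the coordinates $(x^i,y^A,y^A_j)$ on the part of $J^1\pi$ over $U$, where $y^A_j(\tau_e)=dy^A(\tau_e(\partial/\partial x^j))$, and the coordinates $(x^i,y^A,v^i_j,v^A_j,v^A_B)$ on the part of $L_\pi E$ over $U$, where $v^i_j=dx^i(e_j)$, $v^A_j=dy^A(e_j)$, $v^A_B=dy^A(e_B)$; these coordinates define the smooth structures of $J^1\pi$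 and $L_\pi E$. Let the Lie group $H=GL(n,\mathbb R)\times GL(k,\mathbb R)$ act on $L_\pi E$ on the right by $(e_i,e_A)_e\cdot(a,b)=(a^i_j e_i,\ b^B_A e_B)_e$, and let $$\rho:L_\pi E\to J^1\pi,\qquad (e_i,e_A)_e\mapsto \tau_e,\quad \tau_e(\pi_*(e)(e_i))=e_i .$$ This map is well defined, since the vectors $\pi_*(e)(e_i)$ form a basis of $T_{\pi(e)}M$. Then: 1. $\rho:L_\pi E\to J^1\pi$ is a smooth principal fiber bundle with structure group $H$: the action of $H$ is smooth and free, its orbits are exactly the fibers of the smooth surjection $\rho$, and $\rho$ has smooth $H$-equivariant local trivializations around every point of $J^1\pi$. 2. For all adapted coordinates $(x^i,y^A)$ on $U\subseteq E$, the Lagrangian coordinates $u^A_j=\sum_i v^A_i\,\pi^i_j$ on the part of $L_\pi E$ over $U$, where $\pi^i_j(e_i,e_A)_e=e^i(\partial/\partial x^j)$ and $(e^i,e^A)$ is the dual frame, are the pull-backs of the jet coordinates: $u^A_j=y^A_j\circ\rho$. -/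

import Mathlib

open scoped Manifold ContDiff Topology
open Set

noncomputable section

namespace JetFrame

/-- The coordinate space `ℝ^d`. -/
abbrev Euc (d : ℕ) := EuclideanSpace ℝ (Fin d)

/-- The `j`-th standard basis vector of `ℝ^d`. -/
abbrev stdVec {d : ℕ} (j : Fin d) : Euc d := EuclideanSpace.single j (1 : ℝ)

/-- The Lie group `GL(d, ℝ)`: invertible linear endomorphisms of `ℝ^d`, with Mathlib's Lie group
structure. The matrix of `A` has entries `A^i_j = A (stdVec j) i`. -/
abbrev GLd (d : ℕ) := (Euc d →L[ℝ] Euc d)ˣ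

/-- The structure group `H = GL(n) × GL(k)` (block diagonal invertible matrices). -/
abbrev StructureGroup (n k : ℕ) := GLd n × GLd k

/-- The model space of `GL(n) × GL(k)`. -/
abbrev GroupModel (n k : ℕ) := ModelProd (Euc n →L[ℝ] Euc n) (Euc k →L[ℝ] Euc k)

instance (d : ℕ) : ChartedSpace (Euc d →L[ℝ] Euc d) (GLd d) := Units.instChartedSpace

instance (d : ℕ) : LieGroup 𝓘(ℝ, Euc d →L[ℝ] Euc d) ∞ (GLd d) :=
  Units.instLieGroupModelWithCornersSelf

instance (n k : ℕ) : ChartedSpace (GroupModel n k) (StructureGroup n k) := prodChartedSpace _ _ _ _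

instance (n k : ℕ) :
    LieGroup (𝓘(ℝ, Euc n →L[ℝ] Euc n).prod 𝓘(ℝ, Euc k →L[ℝ] Euc k)) ∞ (StructureGroup n k) :=
  Prod.instLieGroup

/-- A smooth fiber bundle `π : E → M` with typical fiber `F`, where `dim M = n`,
`dim E = n + k` and `dim F = k`: over a neighbourhood of every point of `M` there is a
diffeomorphism of the preimage with the product of that neighbourhood and `F`, over `M`. -/
structure SmoothFiberBundle (n k : ℕ) (F E M : Type*)
    [TopologicalSpace F] [ChartedSpace (Euc k) F]
    [TopologicalSpace E] [ChartedSpace (Euc (n + k)) E]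
    [TopologicalSpace M] [ChartedSpace (Euc n) M] where
  proj : E → M
  locally_trivial : ∀ x : M, ∃ t : Bundle.Trivialization F proj, x ∈ t.baseSet ∧
    ContMDiffOn (𝓡 (n + k)) ((𝓡 n).prod (𝓡 k)) ∞ t t.source ∧
    ContMDiffOn ((𝓡 n).prod (𝓡 k)) (𝓡 (n + k)) ∞ t.toOpenPartialHomeomorph.symm t.target

/-- Smooth principal bundles. `ρ : P → B` is a principal bundle with structure group the Lie group
`G`, which acts on `P` on the right (an action of `Gᵐᵒᵖ`; `p · g` is `MulOpposite.op g • p`):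
the action is smooth and free, its orbits are the fibers of the smooth surjection `ρ`, and near
every point of `B` there is a smooth `G`-equivariant local trivialization. -/
structure IsSmoothPrincipalBundle
    {VP HP VB HB VG HG : Type*}
    [NormedAddCommGroup VP] [NormedSpace ℝ VP] [TopologicalSpace HP]
    [NormedAddCommGroup VB] [NormedSpace ℝ VB] [TopologicalSpace HB]
    [NormedAddCommGroup VG] [NormedSpace ℝ VG] [TopologicalSpace HG]
    (IP : ModelWithCorners ℝ VP HP) (IB : ModelWithCorners ℝ VB HB)
    (IG : ModelWithCorners ℝ VG HG)
    {P B : Type*} (G : Type*)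
    [TopologicalSpace P] [ChartedSpace HP P] [IsManifold IP ∞ P]
    [TopologicalSpace B] [ChartedSpace HB B] [IsManifold IB ∞ B]
    [TopologicalSpace G] [ChartedSpace HG G] [Group G] [LieGroup IG ∞ G]
    [MulAction (MulOpposite G) P] (ρ : P → B) : Prop where
  contMDiff_act : ContMDiff (IP.prod IG) IP ∞ (fun q : P × G => MulOpposite.op q.2 • q.1)
  free : ∀ (p : P) (g : G), MulOpposite.op g • p = p → g = 1
  orbits : ∀ p q : P, ρ p = ρ q ↔ ∃ g : G, MulOpposite.op g • p = q
  surjective : Function.Surjective ρ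
  contMDiff_proj : ContMDiff IP IB ∞ ρ
  locally_trivial : ∀ b : B, ∃ t : Bundle.Trivialization G ρ, b ∈ t.baseSet ∧
    ContMDiffOn IP (IB.prod IG) ∞ t t.source ∧
    ContMDiffOn (IB.prod IG) IP ∞ t.toOpenPartialHomeomorph.symm t.target ∧
    ∀ p ∈ t.source, ∀ g : G, t (MulOpposite.op g • p) = ((t p).1, (t p).2 * g)

variable {n k : ℕ} {F E M : Type*}
  [TopologicalSpace F] [ChartedSpace (Euc k) F]
  [TopologicalSpace E] [ChartedSpace (Euc (n + k)) E]
  [TopologicalSpace M] [ChartedSpace (Euc n) M]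

instance (e : E) : FiniteDimensional ℝ (TangentSpace (𝓡 (n + k)) e) :=
  inferInstanceAs (FiniteDimensional ℝ (Euc (n + k)))

instance (x : M) : FiniteDimensional ℝ (TangentSpace (𝓡 n) x) :=
  inferInstanceAs (FiniteDimensional ℝ (Euc n))

instance (x : M) : T2Space (TangentSpace (𝓡 n) x) :=
  inferInstanceAs (T2Space (Euc n))

/-- The tangent map `π_*(e) : T_e E → T_{π(e)} M`. -/
abbrev SmoothFiberBundle.tangentMap (π : SmoothFiberBundle n k F E M) (e : E) :
    TangentSpace (𝓡 (n + k)) e →L[ℝ] TangentSpace (𝓡 n) (π.proj e) :=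
  mfderiv (𝓡 (n + k)) (𝓡 n) π.proj e

/-- The first jet bundle `J¹π`: pairs of a point `e ∈ E` and a linear right inverse
`τ_e : T_{π(e)} M → T_e E` of `π_*(e)`. -/
structure JetBundle (π : SmoothFiberBundle n k F E M) where
  point : E
  lift : TangentSpace (𝓡 n) (π.proj point) →L[ℝ] TangentSpace (𝓡 (n + k)) point
  tangentMap_comp_lift : (π.tangentMap point).comp lift = ContinuousLinearMap.id ℝ _

/-- The adapted frame bundle `L_π E`: bases `(e_i, e_A)` of tangent spaces `T_e E` whose last `k`
vectors are vertical. The vector `e_i` is `basis (Sum.inl i)`, and `e_A` is `basis (Sum.inr A)`. -/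
structure AdaptedFrame (π : SmoothFiberBundle n k F E M) where
  point : E
  basis : Module.Basis (Fin n ⊕ Fin k) ℝ (TangentSpace (𝓡 (n + k)) point)
  vertical : ∀ A : Fin k, π.tangentMap point (basis (Sum.inr A)) = 0

lemma JetBundle.ext_lift {π : SmoothFiberBundle n k F E M} {e : E}
    {τ τ' : TangentSpace (𝓡 n) (π.proj e) →L[ℝ] TangentSpace (𝓡 (n + k)) e}
    {h : (π.tangentMap e).comp τ = ContinuousLinearMap.id ℝ _}
    {h' : (π.tangentMap e).comp τ' = ContinuousLinearMap.id ℝ _} (hτ : τ = τ') :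
    JetBundle.mk e τ h = JetBundle.mk e τ' h' := by
  subst hτ; rfl

lemma AdaptedFrame.ext_basis {π : SmoothFiberBundle n k F E M} {e : E}
    {b b' : Module.Basis (Fin n ⊕ Fin k) ℝ (TangentSpace (𝓡 (n + k)) e)}
    {h : ∀ A : Fin k, π.tangentMap e (b (Sum.inr A)) = 0}
    {h' : ∀ A : Fin k, π.tangentMap e (b' (Sum.inr A)) = 0} (hb : ∀ i, b i = b' i) :
    AdaptedFrame.mk e b h = AdaptedFrame.mk e b' h' := by
  obtain rfl : b = b' := Module.Basis.eq_of_apply_eq hb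
  rfl

/-- Adapted coordinates `(x^i, y^A)` on the open set `total.source ⊆ E`, lying over the coordinates
`x^i` on the open set `base.source ⊆ M`. -/
structure AdaptedChart (π : SmoothFiberBundle n k F E M) where
  total : OpenPartialHomeomorph E (Euc n × Euc k)
  base : OpenPartialHomeomorph M (Euc n)
  contMDiffOn_total : ContMDiffOn (𝓡 (n + k)) 𝓘(ℝ, Euc n × Euc k) ∞ total total.source
  contMDiffOn_total_symm :
    ContMDiffOn 𝓘(ℝ, Euc n × Euc k) (𝓡 (n + k)) ∞ total.symm total.target
  contMDiffOn_base : ContMDiffOn (𝓡 n) 𝓘(ℝ, Euc n) ∞ base base.source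
  contMDiffOn_base_symm : ContMDiffOn 𝓘(ℝ, Euc n) (𝓡 n) ∞ base.symm base.target
  mapsTo_proj : ∀ e ∈ total.source, π.proj e ∈ base.source
  fst_total : ∀ e ∈ total.source, (total e).1 = base (π.proj e)

/-! ### Existence of adapted coordinates -/

lemma SmoothFiberBundle.contMDiff_proj (π : SmoothFiberBundle n k F E M) :
    ContMDiff (𝓡 (n + k)) (𝓡 n) ∞ π.proj := by
  intro e
  obtain ⟨t, ht, h1, -⟩ := π.locally_trivial (π.proj e)
  have hes : e ∈ t.source := t.mem_source.2 ht
  have h2 := (h1 e hes).contMDiffAt (t.open_source.mem_nhds hes)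
  refine (contMDiff_fst.contMDiffAt.comp e h2).congr_of_eventuallyEq ?_
  filter_upwards [t.open_source.mem_nhds hes] with y hy
  exact (t.proj_toFun y hy).symm

lemma SmoothFiberBundle.exists_adaptedChart [IsManifold (𝓡 k) ∞ F] [IsManifold (𝓡 n) ∞ M]
    (π : SmoothFiberBundle n k F E M) (e : E) :
    ∃ c : AdaptedChart π, e ∈ c.total.source := by
  obtain ⟨t, ht, h1, h2⟩ := π.locally_trivial (π.proj e)
  have hes : e ∈ t.source := t.mem_source.2 ht
  set ψ := chartAt (Euc n) (π.proj e)
  set χ := chartAt (Euc k) (t e).2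
  have hψ : ContMDiffOn (𝓡 n) 𝓘(ℝ, Euc n) ∞ ψ ψ.source := contMDiffOn_chart
  have hψ' : ContMDiffOn 𝓘(ℝ, Euc n) (𝓡 n) ∞ ψ.symm ψ.target := contMDiffOn_chart_symm
  have hχ : ContMDiffOn (𝓡 k) 𝓘(ℝ, Euc k) ∞ χ χ.source := contMDiffOn_chart
  have hχ' : ContMDiffOn 𝓘(ℝ, Euc k) (𝓡 k) ∞ χ.symm χ.target := contMDiffOn_chart_symm
  refine ⟨⟨t.toOpenPartialHomeomorph.trans (ψ.prod χ), ψ, ?_, ?_, hψ, hψ', ?_, ?_⟩, ?_⟩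
  · have hs : (t.toOpenPartialHomeomorph.trans (ψ.prod χ)).source ⊆ t.source := by
      intro y hy; simp only [OpenPartialHomeomorph.trans_source] at hy; exact hy.1
    have hm : ∀ y ∈ (t.toOpenPartialHomeomorph.trans (ψ.prod χ)).source,
        (t y).1 ∈ ψ.source ∧ (t y).2 ∈ χ.source := by
      intro y hy; simpa using hy.2
    refine ContMDiffOn.prodMk_space (f := fun y => ψ (t y).1) (g := fun y => χ (t y).2) ?_ ?_
    · exact hψ.comp (contMDiff_fst.comp_contMDiffOn (h1.mono hs)) (fun y hy => (hm y hy).1)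
    · exact hχ.comp (contMDiff_snd.comp_contMDiffOn (h1.mono hs)) (fun y hy => (hm y hy).2)
  · have hm : ∀ z ∈ (t.toOpenPartialHomeomorph.trans (ψ.prod χ)).target,
        z.1 ∈ ψ.target ∧ z.2 ∈ χ.target ∧ (ψ.symm z.1, χ.symm z.2) ∈ t.target := by
      intro z hz
      simp only [OpenPartialHomeomorph.trans_target, OpenPartialHomeomorph.prod_target,
        mem_inter_iff, mem_prod] at hz
      exact ⟨hz.1.1, hz.1.2, hz.2⟩
    have key : ContMDiffOn 𝓘(ℝ, Euc n × Euc k) ((𝓡 n).prod (𝓡 k)) ∞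
        (fun z : Euc n × Euc k => (ψ.symm z.1, χ.symm z.2))
        (t.toOpenPartialHomeomorph.trans (ψ.prod χ)).target := by
      refine ContMDiffOn.prodMk ?_ ?_
      · exact hψ'.comp contDiff_fst.contMDiff.contMDiffOn (fun z hz => (hm z hz).1)
      · exact hχ'.comp contDiff_snd.contMDiff.contMDiffOn (fun z hz => (hm z hz).2.1)
    exact h2.comp key (fun z hz => (hm z hz).2.2)
  · intro y hy
    have hy2 : (t y).1 ∈ ψ.source := by
      have := hy.2; simp at this; exact this.1
    have : y ∈ t.source := by
      simp only [OpenPartialHomeomorph.trans_source] at hy; exact hy.1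
    have h3 : (t y).1 = π.proj y := t.proj_toFun y this
    rwa [h3] at hy2
  · intro y hy
    have : y ∈ t.source := by
      simp only [OpenPartialHomeomorph.trans_source] at hy; exact hy.1
    have h3 : (t y).1 = π.proj y := t.proj_toFun y this
    change ψ (t y).1 = _
    rw [h3]
  · have h3 : (t e).1 = π.proj e := t.proj_toFun e hes
    simp only [OpenPartialHomeomorph.trans_source, mem_inter_iff, mem_preimage,
      OpenPartialHomeomorph.prod_source, mem_prod]
    refine ⟨hes, ?_, mem_chart_source _ _⟩
    change (t e).1 ∈ ψ.source
    rw [h3]; exact mem_chart_source _ _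

namespace AdaptedChart

variable {π : SmoothFiberBundle n k F E M} (c c' : AdaptedChart π)

/-- The differential `(dx^i, dy^A)` of the coordinates at `e`. -/
def dTotal (e : E) : TangentSpace (𝓡 (n + k)) e →L[ℝ] Euc n × Euc k :=
  mfderiv (𝓡 (n + k)) 𝓘(ℝ, Euc n × Euc k) c.total e

/-- The differential `(dx^i)` of the coordinates of the base at `x`. -/
def dBase (x : M) : TangentSpace (𝓡 n) x →L[ℝ] Euc n :=
  mfderiv (𝓡 n) 𝓘(ℝ, Euc n) c.base x

/-- The coordinate vector `∂/∂x^j` at `e ∈ E`. -/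
def ddxTotal (e : E) (j : Fin n) : TangentSpace (𝓡 (n + k)) e :=
  (c.dTotal e).inverse (stdVec j, 0)

/-- The coordinate vector `∂/∂x^j` at `x ∈ M`. -/
def ddxBase (x : M) (j : Fin n) : TangentSpace (𝓡 n) x :=
  (c.dBase x).inverse (stdVec j)

lemma mdiff_total : c.total.MDifferentiable (𝓡 (n + k)) 𝓘(ℝ, Euc n × Euc k) :=
  ⟨c.contMDiffOn_total.mdifferentiableOn (by simp),
    c.contMDiffOn_total_symm.mdifferentiableOn (by simp)⟩

lemma mdiff_base : c.base.MDifferentiable (𝓡 n) 𝓘(ℝ, Euc n) :=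
  ⟨c.contMDiffOn_base.mdifferentiableOn (by simp),
    c.contMDiffOn_base_symm.mdifferentiableOn (by simp)⟩

lemma exists_dTotal_equiv {e : E} (he : e ∈ c.total.source) :
    ∃ L : TangentSpace (𝓡 (n + k)) e ≃L[ℝ] Euc n × Euc k,
      (L : TangentSpace (𝓡 (n + k)) e →L[ℝ] Euc n × Euc k) = c.dTotal e :=
  ⟨c.mdiff_total.mfderiv he, rfl⟩

lemma exists_dBase_equiv {x : M} (hx : x ∈ c.base.source) :
    ∃ L : TangentSpace (𝓡 n) x ≃L[ℝ] Euc n,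
      (L : TangentSpace (𝓡 n) x →L[ℝ] Euc n) = c.dBase x :=
  ⟨c.mdiff_base.mfderiv hx, rfl⟩

lemma dTotal_inverse {e : E} (he : e ∈ c.total.source) (v : Euc n × Euc k) :
    c.dTotal e ((c.dTotal e).inverse v) = v := by
  obtain ⟨L, hL⟩ := c.exists_dTotal_equiv he
  rw [← hL]; simp

lemma inverse_dTotal {e : E} (he : e ∈ c.total.source) (v : TangentSpace (𝓡 (n + k)) e) :
    (c.dTotal e).inverse (c.dTotal e v) = v := by
  obtain ⟨L, hL⟩ := c.exists_dTotal_equiv he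
  rw [← hL]; simp

lemma dBase_inverse {x : M} (hx : x ∈ c.base.source) (v : Euc n) :
    c.dBase x ((c.dBase x).inverse v) = v := by
  obtain ⟨L, hL⟩ := c.exists_dBase_equiv hx
  rw [← hL]; simp

lemma inverse_dBase {x : M} (hx : x ∈ c.base.source) (v : TangentSpace (𝓡 n) x) :
    (c.dBase x).inverse (c.dBase x v) = v := by
  obtain ⟨L, hL⟩ := c.exists_dBase_equiv hx
  rw [← hL]; simp

lemma dBase_tangentMap {e : E} (he : e ∈ c.total.source) (v : TangentSpace (𝓡 (n + k)) e) :
    c.dBase (π.proj e) (π.tangentMap e v) = (c.dTotal e v).1 := by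
  have hπ : MDifferentiableAt (𝓡 (n + k)) (𝓡 n) π.proj e :=
    (π.contMDiff_proj e).mdifferentiableAt (by simp)
  have hb := c.mdiff_base.mdifferentiableAt (c.mapsTo_proj e he)
  have ht := c.mdiff_total.mdifferentiableAt he
  have h1 := mfderiv_comp e hb hπ
  have h2 : MDifferentiableAt 𝓘(ℝ, Euc n × Euc k) 𝓘(ℝ, Euc n) Prod.fst (c.total e) :=
    differentiableAt_fst.mdifferentiableAt
  have h3 := mfderiv_comp e h2 ht
  have h4 : (c.base ∘ π.proj) =ᶠ[𝓝 e] (Prod.fst ∘ c.total) := by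
    filter_upwards [c.total.open_source.mem_nhds he] with y hy
    exact (c.fst_total y hy).symm
  rw [h4.mfderiv_eq, h3, mfderiv_eq_fderiv, fderiv_fst] at h1
  exact (DFunLike.congr_fun h1 v).symm

lemma tangentMap_inverse {e : E} (he : e ∈ c.total.source) (v : Euc n × Euc k) :
    π.tangentMap e ((c.dTotal e).inverse v) = (c.dBase (π.proj e)).inverse v.1 := by
  rw [← c.inverse_dBase (c.mapsTo_proj e he) (π.tangentMap e ((c.dTotal e).inverse v)),
    c.dBase_tangentMap he, c.dTotal_inverse he]

/-- The change of adapted coordinates. -/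
def trans (z : Euc n × Euc k) : Euc n × Euc k := c'.total (c.total.symm z)

/-- The change of base coordinates. -/
def transBase (x : Euc n) : Euc n := c'.base (c.base.symm x)

lemma contDiffOn_trans :
    ContDiffOn ℝ ∞ (c.trans c') (c.total.symm.trans c'.total).source := by
  rw [← contMDiffOn_iff_contDiffOn]
  refine c'.contMDiffOn_total.comp (c.contMDiffOn_total_symm.mono ?_) ?_
  · intro z hz; exact hz.1
  · intro z hz; exact hz.2

lemma contDiffOn_transBase :
    ContDiffOn ℝ ∞ (c.transBase c') (c.base.symm.trans c'.base).source := by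
  rw [← contMDiffOn_iff_contDiffOn]
  refine c'.contMDiffOn_base.comp (c.contMDiffOn_base_symm.mono ?_) ?_
  · intro z hz; exact hz.1
  · intro z hz; exact hz.2

lemma dTotal_trans {e : E} (he : e ∈ c.total.source) (he' : e ∈ c'.total.source)
    (v : TangentSpace (𝓡 (n + k)) e) :
    c'.dTotal e v = fderiv ℝ (c.trans c') (c.total e) (c.dTotal e v) := by
  have hz : c.total e ∈ (c.total.symm.trans c'.total).source := by
    refine ⟨c.total.map_source he, ?_⟩
    change c.total.symm (c.total e) ∈ c'.total.source
    rwa [c.total.left_inv he]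
  have hd : DifferentiableAt ℝ (c.trans c') (c.total e) :=
    ((c.contDiffOn_trans c').contDiffAt
      ((c.total.symm.trans c'.total).open_source.mem_nhds hz)).differentiableAt (by simp)
  have h1 := mfderiv_comp e hd.mdifferentiableAt (c.mdiff_total.mdifferentiableAt he)
  have h2 : ((c.trans c') ∘ c.total) =ᶠ[𝓝 e] c'.total := by
    filter_upwards [c.total.open_source.mem_nhds he] with y hy
    simp [trans, c.total.left_inv hy]
  rw [h2.mfderiv_eq, mfderiv_eq_fderiv] at h1
  exact DFunLike.congr_fun h1 v

lemma dBase_trans {x : M} (hx : x ∈ c.base.source) (hx' : x ∈ c'.base.source)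
    (v : TangentSpace (𝓡 n) x) :
    c'.dBase x v = fderiv ℝ (c.transBase c') (c.base x) (c.dBase x v) := by
  have hz : c.base x ∈ (c.base.symm.trans c'.base).source := by
    refine ⟨c.base.map_source hx, ?_⟩
    change c.base.symm (c.base x) ∈ c'.base.source
    rwa [c.base.left_inv hx]
  have hd : DifferentiableAt ℝ (c.transBase c') (c.base x) :=
    ((c.contDiffOn_transBase c').contDiffAt
      ((c.base.symm.trans c'.base).open_source.mem_nhds hz)).differentiableAt (by simp)
  have h1 := mfderiv_comp x hd.mdifferentiableAt (c.mdiff_base.mdifferentiableAt hx)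
  have h2 : ((c.transBase c') ∘ c.base) =ᶠ[𝓝 x] c'.base := by
    filter_upwards [c.base.open_source.mem_nhds hx] with y hy
    simp [transBase, c.base.left_inv hy]
  rw [h2.mfderiv_eq, mfderiv_eq_fderiv] at h1
  exact DFunLike.congr_fun h1 v

/-! ### Jet coordinates -/

/-- The jet coordinates `(y^A_j)` of a jet, as a linear map `ℝ^n → ℝ^k`. -/
def slope (τ : JetBundle π) : Euc n →L[ℝ] Euc k :=
  (ContinuousLinearMap.snd ℝ (Euc n) (Euc k)).comp
    ((c.dTotal τ.point).comp (τ.lift.comp (c.dBase (π.proj τ.point)).inverse))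

/-- The jet at `e` with given jet coordinates. -/
def jetOf (e : E) (he : e ∈ c.total.source) (s : Euc n →L[ℝ] Euc k) : JetBundle π where
  point := e
  lift := (c.dTotal e).inverse.comp
    (((ContinuousLinearMap.id ℝ (Euc n)).prod s).comp (c.dBase (π.proj e)))
  tangentMap_comp_lift := by
    ext1 v
    have := c.tangentMap_inverse he (c.dBase (π.proj e) v, s (c.dBase (π.proj e) v))
    rw [c.inverse_dBase (c.mapsTo_proj e he)] at this
    exact this

lemma slope_jetOf (e : E) (he : e ∈ c.total.source) (s : Euc n →L[ℝ] Euc k) :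
    c.slope (c.jetOf e he s) = s := by
  ext1 v
  change (c.dTotal e ((c.dTotal e).inverse
    (c.dBase (π.proj e) ((c.dBase (π.proj e)).inverse v),
      s (c.dBase (π.proj e) ((c.dBase (π.proj e)).inverse v))))).2 = s v
  rw [c.dTotal_inverse he, c.dBase_inverse (c.mapsTo_proj e he)]

lemma jetOf_slope (τ : JetBundle π) (he : τ.point ∈ c.total.source) :
    c.jetOf τ.point he (c.slope τ) = τ := by
  obtain ⟨e, τ, hτ⟩ := τ
  change e ∈ c.total.source at he
  refine JetBundle.ext_lift ?_
  ext1 v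
  have h1 : c.dBase (π.proj e) v = (c.dTotal e (τ v)).1 := by
    rw [← c.dBase_tangentMap he]
    congr 1
    exact (DFunLike.congr_fun hτ v).symm
  have h2 : (c.dBase (π.proj e) v, (c.dTotal e (τ v)).2) = c.dTotal e (τ v) := by
    rw [h1]
  have h3 := c.inverse_dTotal he (τ v)
  rw [← h2] at h3
  change (c.dTotal e).inverse (c.dBase (π.proj e) v,
    (c.dTotal e (τ ((c.dBase (π.proj e)).inverse (c.dBase (π.proj e) v)))).2) = τ v
  rw [c.inverse_dBase (c.mapsTo_proj e he)]
  exact h3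

/-- The jet coordinate `y^A_j(τ_e) = dy^A(τ_e(∂/∂x^j))`. -/
def jetCoord (A : Fin k) (j : Fin n) (τ : JetBundle π) : ℝ :=
  (c.dTotal τ.point (τ.lift (c.ddxBase (π.proj τ.point) j))).2 A

lemma slope_apply (A : Fin k) (j : Fin n) (τ : JetBundle π) :
    c.slope τ (stdVec j) A = c.jetCoord A j τ := rfl

/-! ### Frame coordinates -/

/-- The coordinates of the vectors `e_i` of an adapted frame: the pairs `(v^j_i, v^A_i)`. -/
def horCoord (u : AdaptedFrame π) (i : Fin n) : Euc n × Euc k :=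
  c.dTotal u.point (u.basis (Sum.inl i))

/-- The coordinates of the vectors `e_A` of an adapted frame: the vectors `(v^B_A)`; the components
`v^i_A` vanish. -/
def verCoord (u : AdaptedFrame π) (A : Fin k) : Euc k :=
  (c.dTotal u.point (u.basis (Sum.inr A))).2

/-- The Lagrangian coordinate `u^A_j = v^A_i π^i_j` (summed over `i`), where `v^A_i = dy^A(e_i)`
and `π^i_j = e^i(∂/∂x^j)`, with `(e^i, e^A)` the dual frame of `(e_i, e_A)`. -/
def lagrangianCoord (A : Fin k) (j : Fin n) (u : AdaptedFrame π) : ℝ :=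
  ∑ i : Fin n, (c.dTotal u.point (u.basis (Sum.inl i))).2 A *
    u.basis.coord (Sum.inl i) (c.ddxTotal u.point j)

/-- The family of `n + k` vectors of `ℝ^n × ℝ^k` with vertical last `k` members. -/
def family (w : Fin n → Euc n × Euc k) (v : Fin k → Euc k) : Fin n ⊕ Fin k → Euc n × Euc k :=
  Sum.elim w (fun A => (0, v A))

lemma finrank_total_eq : Fintype.card (Fin n ⊕ Fin k) = Module.finrank ℝ (Euc n × Euc k) := by
  simp

/-- The basis of `T_e E` with given frame coordinates. -/
def basisOf (e : E) (he : e ∈ c.total.source) (w : Fin n → Euc n × Euc k) (v : Fin k → Euc k)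
    (h : LinearIndependent ℝ (family w v)) :
    Module.Basis (Fin n ⊕ Fin k) ℝ (TangentSpace (𝓡 (n + k)) e) :=
  (Module.Basis.mk h (h.span_eq_top_of_card_eq_finrank' finrank_total_eq).ge).map
    (c.exists_dTotal_equiv he).choose.symm.toLinearEquiv

lemma basisOf_apply (e : E) (he : e ∈ c.total.source) (w : Fin n → Euc n × Euc k)
    (v : Fin k → Euc k) (h : LinearIndependent ℝ (family w v)) (i : Fin n ⊕ Fin k) :
    c.basisOf e he w v h i = (c.dTotal e).inverse (family w v i) := by
  have hL := (c.exists_dTotal_equiv he).choose_spec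
  rw [← hL]
  simp [basisOf]

/-- The adapted frame at `e` with given frame coordinates. -/
def frameOf (e : E) (he : e ∈ c.total.source) (w : Fin n → Euc n × Euc k) (v : Fin k → Euc k)
    (h : LinearIndependent ℝ (family w v)) : AdaptedFrame π where
  point := e
  basis := c.basisOf e he w v h
  vertical := by
    intro A
    rw [c.basisOf_apply, c.tangentMap_inverse he]
    simp [family]

lemma dTotal_basisOf (e : E) (he : e ∈ c.total.source) (w : Fin n → Euc n × Euc k)
    (v : Fin k → Euc k) (h : LinearIndependent ℝ (family w v)) (i : Fin n ⊕ Fin k) :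
    c.dTotal e (c.basisOf e he w v h i) = family w v i := by
  rw [c.basisOf_apply, c.dTotal_inverse he]

lemma family_coord (u : AdaptedFrame π) (he : u.point ∈ c.total.source) (i : Fin n ⊕ Fin k) :
    family (c.horCoord u) (c.verCoord u) i = c.dTotal u.point (u.basis i) := by
  cases i with
  | inl i => rfl
  | inr A =>
    have h := c.dBase_tangentMap he (u.basis (Sum.inr A))
    rw [u.vertical, map_zero] at h
    exact Prod.ext h rfl

lemma linearIndependent_coord (u : AdaptedFrame π) (he : u.point ∈ c.total.source) :
    LinearIndependent ℝ (family (c.horCoord u) (c.verCoord u)) := by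
  obtain ⟨L, hL⟩ := c.exists_dTotal_equiv he
  have h : family (c.horCoord u) (c.verCoord u) = fun i => L (u.basis i) := by
    funext i
    rw [c.family_coord u he, ← hL]; rfl
  rw [h]
  exact u.basis.linearIndependent.map' L.toLinearEquiv.toLinearMap (LinearEquiv.ker _)

lemma frameOf_coord (u : AdaptedFrame π) (he : u.point ∈ c.total.source) :
    c.frameOf u.point he _ _ (c.linearIndependent_coord u he) = u := by
  have h : ∀ i, c.basisOf u.point he _ _ (c.linearIndependent_coord u he) i = u.basis i := by
    intro i
    rw [c.basisOf_apply, c.family_coord u he, c.inverse_dTotal he]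
  obtain ⟨e, b, hb⟩ := u
  exact AdaptedFrame.ext_basis h

end AdaptedChart

/-! ### The smooth structures of `J¹π` and `L_π E` -/

section Smooth

variable [IsManifold (𝓡 k) ∞ F] [IsManifold (𝓡 n) ∞ M] (π : SmoothFiberBundle n k F E M)

/-- Some adapted chart around `e`. -/
def adaptedChartAt (e : E) : AdaptedChart π := (π.exists_adaptedChart e).choose

lemma mem_adaptedChartAt (e : E) : e ∈ (adaptedChartAt π e).total.source :=
  (π.exists_adaptedChart e).choose_spec

/-- The model space of `J¹π`, with coordinates `(x^i, y^A, y^A_j)`. -/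
abbrev JetModel (n k : ℕ) := (Euc n × Euc k) × (Euc n →L[ℝ] Euc k)

/-- The model space of `L_π E`, with coordinates `(x^i, y^A, v^i_j, v^A_j, v^A_B)`. -/
abbrev FrameModel (n k : ℕ) :=
  (Euc n × Euc k) × (Fin n → Euc n × Euc k) × (Fin k → Euc k)

variable {π}

open Classical in
/-- The standard jet coordinates `(x^i, y^A, y^A_j)` on `J¹π` induced by adapted coordinates. -/
def jetChart (c : AdaptedChart π) : PartialEquiv (JetBundle π) (JetModel n k) where
  toFun τ := (c.total τ.point, c.slope τ)
  invFun q := if h : q.1 ∈ c.total.target then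
      c.jetOf (c.total.symm q.1) (c.total.map_target h) q.2
    else (adaptedChartAt π (c.total.symm q.1)).jetOf _ (mem_adaptedChartAt π _) 0
  source := {τ | τ.point ∈ c.total.source}
  target := c.total.target ×ˢ univ
  map_source' τ hτ := ⟨c.total.map_source hτ, mem_univ _⟩
  map_target' q hq := by
    rw [dif_pos hq.1]; exact c.total.map_target hq.1
  left_inv' τ hτ := by
    have h1 : c.total τ.point ∈ c.total.target := c.total.map_source hτ
    rw [dif_pos h1]
    have h2 : ∀ (e : E) (he : e ∈ c.total.source), e = τ.point →
        c.jetOf e he (c.slope τ) = τ := by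
      rintro e he rfl
      exact c.jetOf_slope τ he
    exact h2 _ _ (c.total.left_inv hτ)
  right_inv' q hq := by
    rw [dif_pos hq.1]
    exact Prod.ext (c.total.right_inv hq.1) (c.slope_jetOf _ _ _)

lemma linearIndependent_std :
    LinearIndependent ℝ (AdaptedChart.family (n := n) (k := k)
      (fun i => (stdVec i, 0)) (fun A => stdVec A)) := by
  let b := (EuclideanSpace.basisFun (Fin n) ℝ).toBasis.prod
    (EuclideanSpace.basisFun (Fin k) ℝ).toBasis
  have h : AdaptedChart.family (n := n) (k := k)
      (fun i => (stdVec i, 0)) (fun A => stdVec A) = b := by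
    funext i
    cases i <;> simp [AdaptedChart.family, b]
  rw [h]
  exact b.linearIndependent

open Classical in
/-- The frame coordinates `(x^i, y^A, v^i_j, v^A_j, v^A_B)` on `L_π E` induced by adapted
coordinates. -/
def frameChart (c : AdaptedChart π) : PartialEquiv (AdaptedFrame π) (FrameModel n k) where
  toFun u := (c.total u.point, c.horCoord u, c.verCoord u)
  invFun q := if h : q.1 ∈ c.total.target ∧
        LinearIndependent ℝ (AdaptedChart.family q.2.1 q.2.2) then
      c.frameOf (c.total.symm q.1) (c.total.map_target h.1) q.2.1 q.2.2 h.2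
    else (adaptedChartAt π (c.total.symm q.1)).frameOf _ (mem_adaptedChartAt π _) _ _
      linearIndependent_std
  source := {u | u.point ∈ c.total.source}
  target := {q | q.1 ∈ c.total.target ∧ LinearIndependent ℝ (AdaptedChart.family q.2.1 q.2.2)}
  map_source' u hu := ⟨c.total.map_source hu, c.linearIndependent_coord u hu⟩
  map_target' q hq := by
    have hq : _ ∧ _ := hq
    rw [dif_pos hq]; exact c.total.map_target hq.1
  left_inv' u hu := by
    have h1 : c.total u.point ∈ c.total.target ∧
        LinearIndependent ℝ (AdaptedChart.family (c.horCoord u) (c.verCoord u)) :=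
      ⟨c.total.map_source hu, c.linearIndependent_coord u hu⟩
    rw [dif_pos h1]
    have h2 : ∀ (e : E) (he : e ∈ c.total.source), e = u.point →
        c.frameOf e he _ _ (c.linearIndependent_coord u hu) = u := by
      rintro e he rfl
      exact c.frameOf_coord u he
    exact h2 _ _ (c.total.left_inv hu)
  right_inv' q hq := by
    have hq : _ ∧ _ := hq
    rw [dif_pos hq]
    refine Prod.ext (c.total.right_inv hq.1) (Prod.ext ?_ ?_)
    · funext i
      exact c.dTotal_basisOf _ (c.total.map_target hq.1) _ _ hq.2 (Sum.inl i)
    · funext A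
      exact congrArg Prod.snd
        (c.dTotal_basisOf _ (c.total.map_target hq.1) _ _ hq.2 (Sum.inr A))

lemma jetChart_symm_point (c : AdaptedChart π) (q : JetModel n k) :
    ((jetChart c).symm q).point = c.total.symm q.1 := by
  by_cases h : q.1 ∈ c.total.target
  · exact congrArg JetBundle.point (dif_pos h)
  · exact congrArg JetBundle.point (dif_neg h)

lemma frameChart_symm_point (c : AdaptedChart π) (q : FrameModel n k) :
    ((frameChart c).symm q).point = c.total.symm q.1 := by
  by_cases h : q.1 ∈ c.total.target ∧ LinearIndependent ℝ (AdaptedChart.family q.2.1 q.2.2)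
  · exact congrArg AdaptedFrame.point (dif_pos h)
  · exact congrArg AdaptedFrame.point (dif_neg h)

lemma jetChart_trans_source (c c' : AdaptedChart π) :
    ((jetChart c).symm.trans (jetChart c')).source =
      (c.total.symm.trans c'.total).source ×ˢ univ := by
  ext q
  change (q ∈ c.total.target ×ˢ univ ∧ ((jetChart c).symm q).point ∈ c'.total.source) ↔
    ((q.1 ∈ c.total.target ∧ c.total.symm q.1 ∈ c'.total.source) ∧ q.2 ∈ univ)
  rw [jetChart_symm_point]
  simp

lemma frameChart_trans_source (c c' : AdaptedChart π) :
    ((frameChart c).symm.trans (frameChart c')).source =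
      {q | q.1 ∈ (c.total.symm.trans c'.total).source ∧
        LinearIndependent ℝ (AdaptedChart.family q.2.1 q.2.2)} := by
  ext q
  change ((q.1 ∈ c.total.target ∧ LinearIndependent ℝ (AdaptedChart.family q.2.1 q.2.2)) ∧
      ((frameChart c).symm q).point ∈ c'.total.source) ↔
    ((q.1 ∈ c.total.target ∧ c.total.symm q.1 ∈ c'.total.source) ∧
      LinearIndependent ℝ (AdaptedChart.family q.2.1 q.2.2))
  rw [frameChart_symm_point]
  tauto

/-- The change of jet coordinates. -/
def jetTrans (c c' : AdaptedChart π) (q : JetModel n k) : JetModel n k :=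
  (c.trans c' q.1,
    (ContinuousLinearMap.snd ℝ (Euc n) (Euc k)).comp
      ((fderiv ℝ (c.trans c') q.1).comp
        ((ContinuousLinearMap.inl ℝ (Euc n) (Euc k) +
          (ContinuousLinearMap.inr ℝ (Euc n) (Euc k)).comp q.2).comp
            (fderiv ℝ (c'.transBase c) (c.trans c' q.1).1))))

/-- The change of frame coordinates. -/
def frameTrans (c c' : AdaptedChart π) (q : FrameModel n k) : FrameModel n k :=
  (c.trans c' q.1, (fun i => fderiv ℝ (c.trans c') q.1 (q.2.1 i)),
    (fun A => (fderiv ℝ (c.trans c') q.1 (0, q.2.2 A)).2))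

lemma jetChart_trans_eqOn (c c' : AdaptedChart π) :
    EqOn ((jetChart c).symm.trans (jetChart c')) (jetTrans c c')
      ((jetChart c).symm.trans (jetChart c')).source := by
  intro q hq
  rw [jetChart_trans_source] at hq
  have h1 : q.1 ∈ c.total.target := hq.1.1
  have h2 : c.total.symm q.1 ∈ c'.total.source := hq.1.2
  set e := c.total.symm q.1 with he
  have h3 : e ∈ c.total.source := c.total.map_target h1
  have h4 : (jetChart c).symm q = c.jetOf e h3 q.2 := dif_pos h1
  have h5 : c.total e = q.1 := c.total.right_inv h1
  change jetChart c' ((jetChart c).symm q) = _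
  rw [h4]
  refine Prod.ext rfl ?_
  ext1 v
  have hb := c.mapsTo_proj e h3
  have hb' := c'.mapsTo_proj e h2
  have h6 : c.dBase (π.proj e) ((c'.dBase (π.proj e)).inverse v) =
      fderiv ℝ (c'.transBase c) (c.trans c' q.1).1 v := by
    rw [c'.dBase_trans c hb' hb, c'.dBase_inverse hb', ← c'.fst_total e h2]
    rfl
  change (c'.dTotal e ((c.dTotal e).inverse
    (c.dBase (π.proj e) ((c'.dBase (π.proj e)).inverse v),
      q.2 (c.dBase (π.proj e) ((c'.dBase (π.proj e)).inverse v))))).2 = _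
  rw [c.dTotal_trans c' h3 h2, c.dTotal_inverse h3, h5, h6]
  simp [jetTrans, ← Prod.snd_add, ← map_add]

lemma frameChart_trans_eqOn (c c' : AdaptedChart π) :
    EqOn ((frameChart c).symm.trans (frameChart c')) (frameTrans c c')
      ((frameChart c).symm.trans (frameChart c')).source := by
  intro q hq
  rw [frameChart_trans_source] at hq
  have h1 : q.1 ∈ c.total.target := hq.1.1
  have h2 : c.total.symm q.1 ∈ c'.total.source := hq.1.2
  set e := c.total.symm q.1 with he
  have h3 : e ∈ c.total.source := c.total.map_target h1
  have h4 : (frameChart c).symm q = c.frameOf e h3 q.2.1 q.2.2 hq.2 := dif_pos ⟨h1, hq.2⟩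
  have h5 : c.total e = q.1 := c.total.right_inv h1
  have h6 : ∀ i, c'.dTotal e (c.basisOf e h3 q.2.1 q.2.2 hq.2 i) =
      fderiv ℝ (c.trans c') q.1 (AdaptedChart.family q.2.1 q.2.2 i) := by
    intro i
    rw [c.dTotal_trans c' h3 h2, h5, c.dTotal_basisOf]
  change frameChart c' ((frameChart c).symm q) = _
  rw [h4]
  refine Prod.ext rfl (Prod.ext ?_ ?_)
  · funext i; exact h6 (Sum.inl i)
  · funext A; exact congrArg Prod.snd (h6 (Sum.inr A))

lemma contDiffOn_jetTrans (c c' : AdaptedChart π) :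
    ContDiffOn ℝ ∞ (jetTrans c c') ((c.total.symm.trans c'.total).source ×ˢ univ) := by
  have hT := c.contDiffOn_trans c'
  have hT' : ContDiffOn ℝ ∞ (fderiv ℝ (c.trans c')) (c.total.symm.trans c'.total).source :=
    hT.fderiv_of_isOpen (c.total.symm.trans c'.total).open_source (by simp)
  have hB' : ContDiffOn ℝ ∞ (fderiv ℝ (c'.transBase c)) (c'.base.symm.trans c.base).source :=
    (c'.contDiffOn_transBase c).fderiv_of_isOpen (c'.base.symm.trans c.base).open_source (by simp)
  have hf : ContDiffOn ℝ ∞ (fun q : JetModel n k => q.1)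
    ((c.total.symm.trans c'.total).source ×ˢ univ) := contDiff_fst.contDiffOn
  have hm : MapsTo (fun q : JetModel n k => q.1)
      ((c.total.symm.trans c'.total).source ×ˢ univ) (c.total.symm.trans c'.total).source :=
    fun q hq => hq.1
  have h1 := hT.comp hf hm
  have h2 := hT'.comp hf hm
  have h3 : ContDiffOn ℝ ∞ (fun q : JetModel n k => fderiv ℝ (c'.transBase c) (c.trans c' q.1).1)
      ((c.total.symm.trans c'.total).source ×ˢ univ) := by
    refine hB'.comp (contDiff_fst.comp_contDiffOn h1) ?_
    rintro q ⟨⟨hq1, hq2⟩, -⟩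
    have hq2' : c.total.symm q.1 ∈ c'.total.source := hq2
    have hq3 : c.total.symm q.1 ∈ c.total.source := c.total.map_target hq1
    have h4 : (c.trans c' q.1).1 = c'.base (π.proj (c.total.symm q.1)) := c'.fst_total _ hq2'
    change (c.trans c' q.1).1 ∈ c'.base.target ∧ c'.base.symm (c.trans c' q.1).1 ∈ c.base.source
    rw [h4]
    refine ⟨c'.base.map_source (c'.mapsTo_proj _ hq2'), ?_⟩
    rw [c'.base.left_inv (c'.mapsTo_proj _ hq2')]
    exact c.mapsTo_proj _ hq3
  refine h1.prodMk (contDiffOn_const.clm_comp (h2.clm_comp ((ContDiffOn.clm_comp ?_ h3))))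
  exact contDiffOn_const.add (contDiffOn_const.clm_comp contDiff_snd.contDiffOn)

lemma contDiffOn_frameTrans (c c' : AdaptedChart π) :
    ContDiffOn ℝ ∞ (frameTrans c c') {q | q.1 ∈ (c.total.symm.trans c'.total).source ∧
        LinearIndependent ℝ (AdaptedChart.family q.2.1 q.2.2)} := by
  have hT := c.contDiffOn_trans c'
  have hT' : ContDiffOn ℝ ∞ (fderiv ℝ (c.trans c')) (c.total.symm.trans c'.total).source :=
    hT.fderiv_of_isOpen (c.total.symm.trans c'.total).open_source (by simp)
  set S : Set (FrameModel n k) := {q | q.1 ∈ (c.total.symm.trans c'.total).source ∧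
        LinearIndependent ℝ (AdaptedChart.family q.2.1 q.2.2)}
  have hf : ContDiffOn ℝ ∞ (fun q : FrameModel n k => q.1) S := contDiff_fst.contDiffOn
  have hm : MapsTo (fun q : FrameModel n k => q.1) S (c.total.symm.trans c'.total).source :=
    fun q hq => hq.1
  have h1 := hT.comp hf hm
  have h2 := hT'.comp hf hm
  refine h1.prodMk (ContDiffOn.prodMk ?_ ?_)
  · refine contDiffOn_pi.2 (fun i => h2.clm_apply ?_)
    have : ContDiff ℝ ∞ (fun q : FrameModel n k => q.2.1 i) := by fun_prop
    exact this.contDiffOn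
  · refine contDiffOn_pi.2 (fun A => contDiff_snd.comp_contDiffOn (h2.clm_apply ?_))
    have : ContDiff ℝ ∞ (fun q : FrameModel n k => ((0 : Euc n), q.2.2 A)) := by fun_prop
    exact this.contDiffOn

lemma isOpen_frameTrans_source (c c' : AdaptedChart π) :
    IsOpen {q : FrameModel n k | q.1 ∈ (c.total.symm.trans c'.total).source ∧
        LinearIndependent ℝ (AdaptedChart.family q.2.1 q.2.2)} := by
  refine ((c.total.symm.trans c'.total).open_source.preimage continuous_fst).inter ?_
  have h : Continuous (fun q : FrameModel n k => AdaptedChart.family q.2.1 q.2.2) := by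
    refine continuous_pi (fun i => ?_)
    cases i with
    | inl i => simp only [AdaptedChart.family, Sum.elim_inl]; fun_prop
    | inr A => simp only [AdaptedChart.family, Sum.elim_inr]; fun_prop
  exact (isOpen_setOfPred_linearIndependent (𝕜 := ℝ)).preimage h

variable (π)

/-- The atlas of standard jet coordinates on `J¹π`. -/
def jetCore : ChartedSpaceCore (JetModel n k) (JetBundle π) where
  atlas := range jetChart
  chartAt τ := jetChart (adaptedChartAt π τ.point)
  mem_chart_source τ := mem_adaptedChartAt π τ.point
  chart_mem_atlas τ := mem_range_self _
  open_source := by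
    rintro _ _ ⟨c, rfl⟩ ⟨c', rfl⟩
    rw [jetChart_trans_source]
    exact (c.total.symm.trans c'.total).open_source.prod isOpen_univ
  continuousOn_toFun := by
    rintro _ _ ⟨c, rfl⟩ ⟨c', rfl⟩
    refine ContinuousOn.congr ?_ (jetChart_trans_eqOn c c')
    rw [jetChart_trans_source]
    exact (contDiffOn_jetTrans c c').continuousOn

/-- The atlas of frame coordinates on `L_π E`. -/
def frameCore : ChartedSpaceCore (FrameModel n k) (AdaptedFrame π) where
  atlas := range frameChart
  chartAt u := frameChart (adaptedChartAt π u.point)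
  mem_chart_source u := mem_adaptedChartAt π u.point
  chart_mem_atlas u := mem_range_self _
  open_source := by
    rintro _ _ ⟨c, rfl⟩ ⟨c', rfl⟩
    rw [frameChart_trans_source]
    exact isOpen_frameTrans_source c c'
  continuousOn_toFun := by
    rintro _ _ ⟨c, rfl⟩ ⟨c', rfl⟩
    refine ContinuousOn.congr ?_ (frameChart_trans_eqOn c c')
    rw [frameChart_trans_source]
    exact (contDiffOn_frameTrans c c').continuousOn

instance : TopologicalSpace (JetBundle π) := (jetCore π).toTopologicalSpace
instance : ChartedSpace (JetModel n k) (JetBundle π) := (jetCore π).toChartedSpace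
instance : TopologicalSpace (AdaptedFrame π) := (frameCore π).toTopologicalSpace
instance : ChartedSpace (FrameModel n k) (AdaptedFrame π) := (frameCore π).toChartedSpace

instance : IsManifold 𝓘(ℝ, JetModel n k) ∞ (JetBundle π) := by
  refine isManifold_of_contDiffOn _ _ _ ?_
  rintro e e' he he'
  obtain ⟨_, ⟨_, rfl⟩, he⟩ := he
  obtain ⟨_, ⟨_, rfl⟩, he'⟩ := he'
  simp only [mem_iUnion] at he he'
  obtain ⟨⟨c, rfl⟩, rfl⟩ := he
  obtain ⟨⟨c', rfl⟩, rfl⟩ := he'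
  have h : ContDiffOn ℝ ∞ ((jetChart c).symm.trans (jetChart c'))
      ((jetChart c).symm.trans (jetChart c')).source := by
    refine ContDiffOn.congr ?_ (jetChart_trans_eqOn c c')
    rw [jetChart_trans_source]
    exact contDiffOn_jetTrans c c'
  exact h.mono (fun q hq => hq.1)

instance : IsManifold 𝓘(ℝ, FrameModel n k) ∞ (AdaptedFrame π) := by
  refine isManifold_of_contDiffOn _ _ _ ?_
  rintro e e' he he'
  obtain ⟨_, ⟨_, rfl⟩, he⟩ := he
  obtain ⟨_, ⟨_, rfl⟩, he'⟩ := he'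
  simp only [mem_iUnion] at he he'
  obtain ⟨⟨c, rfl⟩, rfl⟩ := he
  obtain ⟨⟨c', rfl⟩, rfl⟩ := he'
  have h : ContDiffOn ℝ ∞ ((frameChart c).symm.trans (frameChart c'))
      ((frameChart c).symm.trans (frameChart c')).source := by
    refine ContDiffOn.congr ?_ (frameChart_trans_eqOn c c')
    rw [frameChart_trans_source]
    exact contDiffOn_frameTrans c c'
  exact h.mono (fun q hq => hq.1)

/-! ### The projection `ρ : L_π E → J¹π` -/

lemma tangentMap_surjective (e : E) : Function.Surjective (π.tangentMap e) := by
  intro v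
  have he := mem_adaptedChartAt π e
  set c := adaptedChartAt π e
  refine ⟨(c.dTotal e).inverse (c.dBase (π.proj e) v, 0), ?_⟩
  rw [c.tangentMap_inverse he, c.inverse_dBase (c.mapsTo_proj e he)]

variable {π}

lemma top_le_span_proj (u : AdaptedFrame π) :
    ⊤ ≤ Submodule.span ℝ
      (range (fun i : Fin n => π.tangentMap u.point (u.basis (Sum.inl i)))) := by
  rintro v -
  obtain ⟨w, rfl⟩ := tangentMap_surjective π u.point v
  rw [← u.basis.sum_repr w, map_sum]
  refine Submodule.sum_mem _ (fun i _ => ?_)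
  rw [map_smul]
  refine Submodule.smul_mem _ _ ?_
  cases i with
  | inl i => exact Submodule.subset_span (mem_range_self i)
  | inr A => rw [u.vertical]; exact Submodule.zero_mem _

lemma card_eq_finrank_base (x : M) :
    Fintype.card (Fin n) = Module.finrank ℝ (TangentSpace (𝓡 n) x) := by
  change _ = Module.finrank ℝ (Euc n)
  simp

/-- The basis `ê_i = π_*(e)(e_i)` of `T_{π(e)} M` given by an adapted frame `(e_i, e_A)` at `e`. -/
def projBasis (u : AdaptedFrame π) :
    Module.Basis (Fin n) ℝ (TangentSpace (𝓡 n) (π.proj u.point)) :=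
  basisOfTopLeSpanOfCardEqFinrank _ (top_le_span_proj u) (card_eq_finrank_base _)

lemma projBasis_apply (u : AdaptedFrame π) (i : Fin n) :
    projBasis u i = π.tangentMap u.point (u.basis (Sum.inl i)) := by
  simp [projBasis]

/-- The projection `ρ : L_π E → J¹π`, sending an adapted frame `(e_i, e_A)` at `e` to the linear
map `T_{π(e)} M → T_e E` with `π_*(e)(e_i) ↦ e_i`. -/
def rho (u : AdaptedFrame π) : JetBundle π where
  point := u.point
  lift := LinearMap.toContinuousLinearMap
    ((projBasis u).constr ℝ (fun i => u.basis (Sum.inl i)))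
  tangentMap_comp_lift := by
    apply ContinuousLinearMap.coe_injective
    refine (projBasis u).ext (fun i => ?_)
    change π.tangentMap u.point
      ((projBasis u).constr ℝ (fun i => u.basis (Sum.inl i)) (projBasis u i)) = projBasis u i
    rw [Module.Basis.constr_basis, projBasis_apply]

end Smooth

/-! ### The right action of `GL(n) × GL(k)` on `L_π E` -/

/-- The standard basis of `ℝ^n × ℝ^k`. -/
def stdBasis (n k : ℕ) : Module.Basis (Fin n ⊕ Fin k) ℝ (Euc n × Euc k) :=
  (EuclideanSpace.basisFun (Fin n) ℝ).toBasis.prod (EuclideanSpace.basisFun (Fin k) ℝ).toBasis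

lemma stdBasis_inl (i : Fin n) : stdBasis n k (Sum.inl i) = (stdVec i, 0) := by
  simp [stdBasis]

lemma stdBasis_inr (A : Fin k) : stdBasis n k (Sum.inr A) = (0, stdVec A) := by
  simp [stdBasis]

/-- The block diagonal linear map of `ℝ^n × ℝ^k` given by `(A, B) ∈ GL(n) × GL(k)`. -/
def blockMap (g : StructureGroup n k) : (Euc n × Euc k) ≃ₗ[ℝ] Euc n × Euc k :=
  (ContinuousLinearEquiv.unitsEquiv ℝ (Euc n) g.1).toLinearEquiv.prodCongr
    (ContinuousLinearEquiv.unitsEquiv ℝ (Euc k) g.2).toLinearEquiv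

lemma blockMap_apply (g : StructureGroup n k) (v : Euc n × Euc k) :
    blockMap g v = ((g.1 : Euc n →L[ℝ] Euc n) v.1, (g.2 : Euc k →L[ℝ] Euc k) v.2) := rfl

section ChangeBasis

variable {V : Type*} [AddCommGroup V] [Module ℝ V]

/-- A frame `(e_i, e_A)` of `V` as a linear isomorphism `ℝ^n × ℝ^k → V`. -/
def frameMap (b : Module.Basis (Fin n ⊕ Fin k) ℝ V) : (Euc n × Euc k) ≃ₗ[ℝ] V :=
  (stdBasis n k).equiv b (Equiv.refl _)

lemma frameMap_stdBasis (b : Module.Basis (Fin n ⊕ Fin k) ℝ V) (i : Fin n ⊕ Fin k) :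
    frameMap b (stdBasis n k i) = b i := by
  simp [frameMap]

lemma frameMap_apply (b : Module.Basis (Fin n ⊕ Fin k) ℝ V) (v : Euc n × Euc k) :
    frameMap b v = ∑ i, v.1 i • b (Sum.inl i) + ∑ A, v.2 A • b (Sum.inr A) := by
  conv_lhs => rw [← (stdBasis n k).sum_repr v, map_sum]
  simp only [map_smul, frameMap_stdBasis, Fintype.sum_sum_type]
  simp [stdBasis]

/-- The frame `(e_i, e_A) · (A, B) = (A^i_j e_i, B^A_B e_A)`. -/
def changeBasis (b : Module.Basis (Fin n ⊕ Fin k) ℝ V) (g : StructureGroup n k) :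
    Module.Basis (Fin n ⊕ Fin k) ℝ V :=
  (stdBasis n k).map ((blockMap g).trans (frameMap b))

lemma changeBasis_inl (b : Module.Basis (Fin n ⊕ Fin k) ℝ V) (g : StructureGroup n k)
    (j : Fin n) :
    changeBasis b g (Sum.inl j) =
      ∑ i, (g.1 : Euc n →L[ℝ] Euc n) (stdVec j) i • b (Sum.inl i) := by
  simp [changeBasis, stdBasis_inl, blockMap_apply, frameMap_apply]

lemma changeBasis_inr (b : Module.Basis (Fin n ⊕ Fin k) ℝ V) (g : StructureGroup n k)
    (B : Fin k) :
    changeBasis b g (Sum.inr B) =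
      ∑ A, (g.2 : Euc k →L[ℝ] Euc k) (stdVec B) A • b (Sum.inr A) := by
  simp [changeBasis, stdBasis_inr, blockMap_apply, frameMap_apply]

lemma frameMap_changeBasis (b : Module.Basis (Fin n ⊕ Fin k) ℝ V) (g : StructureGroup n k) :
    frameMap (changeBasis b g) = (blockMap g).trans (frameMap b) := by
  refine (stdBasis n k).ext' (fun i => ?_)
  rw [frameMap_stdBasis]
  simp [changeBasis]

lemma changeBasis_one (b : Module.Basis (Fin n ⊕ Fin k) ℝ V) : changeBasis b 1 = b := by
  refine Module.Basis.eq_of_apply_eq (fun i => ?_)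
  have h : blockMap (1 : StructureGroup n k) (stdBasis n k i) = stdBasis n k i := rfl
  rw [changeBasis, Module.Basis.map_apply, LinearEquiv.trans_apply, h, frameMap_stdBasis]

lemma changeBasis_mul (b : Module.Basis (Fin n ⊕ Fin k) ℝ V) (g h : StructureGroup n k) :
    changeBasis b (g * h) = changeBasis (changeBasis b g) h := by
  refine Module.Basis.eq_of_apply_eq (fun i => ?_)
  conv_rhs => rw [changeBasis, frameMap_changeBasis]
  rfl

end ChangeBasis

namespace AdaptedFrame

variable {π : SmoothFiberBundle n k F E M}

/-- The right action `(e_i, e_A)_e · (A, B) = (A^i_j e_i, B^A_B e_A)_e`. -/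
def act (u : AdaptedFrame π) (g : StructureGroup n k) : AdaptedFrame π where
  point := u.point
  basis := changeBasis u.basis g
  vertical := by
    intro A
    simp [changeBasis_inr, u.vertical]

instance : MulAction (MulOpposite (StructureGroup n k)) (AdaptedFrame π) where
  smul g u := u.act g.unop
  one_smul u := AdaptedFrame.ext_basis (fun i => by
    rw [MulOpposite.unop_one, changeBasis_one])
  mul_smul g h u := AdaptedFrame.ext_basis (fun i => by
    rw [MulOpposite.unop_mul, changeBasis_mul]; rfl)

lemma op_smul_eq (u : AdaptedFrame π) (g : StructureGroup n k) :
    MulOpposite.op g • u = u.act g := rfl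

end AdaptedFrame

end JetFrame

end

open JetFrame

/-!
In adapted coordinates the matrix of an adapted frame `u` is block triangular, with columns
`(a, m)` for the vectors `e_j` and `(0, b)` for the vectors `e_B`, where `a` and `b` are invertible.
The vectors `e_j` lie in the image of `τ_e`, which is the graph of the slope `s` of the jet `ρ(u)`;
hence `m = s a`, and `u` amounts to the triple `(s, a, b)`, on which `H` acts by right
multiplication on `(a, b)`. So `u ↦ (ρ(u), (a, b))` is a smooth equivariant local trivialization,
and all other properties of a principal bundle, even the smoothness of the action, are local and
can be read off in it.

Since `e_A` is vertical, `τ_e ∘ π_*` is the projection `∑ i, e_i ⊗ e^i`; applied to `∂/∂x^j` in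
`T_e E` this compares the Lagrangian coordinates with the jet coordinates.
-/

noncomputable section

namespace JetFrame

section PrincipalBundleCriterion

open MulOpposite (op)

variable {VP HP VB HB VG HG : Type*}
  [NormedAddCommGroup VP] [NormedSpace ℝ VP] [TopologicalSpace HP]
  [NormedAddCommGroup VB] [NormedSpace ℝ VB] [TopologicalSpace HB]
  [NormedAddCommGroup VG] [NormedSpace ℝ VG] [TopologicalSpace HG]
  {IP : ModelWithCorners ℝ VP HP} {IB : ModelWithCorners ℝ VB HB}
  {IG : ModelWithCorners ℝ VG HG} {P B G : Type*}
  [TopologicalSpace P] [ChartedSpace HP P] [TopologicalSpace B] [ChartedSpace HB B]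
  [TopologicalSpace G] [ChartedSpace HG G] [Group G] [MulAction (MulOpposite G) P] {ρ : P → B}

variable (IP IB IG) in
/-- A trivialization `p ↦ (ρ p, φ p)` which is a diffeomorphism and satisfies `φ (p · g) = φ p * g`.
The right action is encoded, as in `IsSmoothPrincipalBundle`, as an action of `Gᵐᵒᵖ`. -/
structure IsSmoothEquivariant (t : Bundle.Trivialization G ρ) : Prop where
  contMDiffOn : ContMDiffOn IP (IB.prod IG) ∞ t t.source
  contMDiffOn_symm : ContMDiffOn (IB.prod IG) IP ∞ t.toOpenPartialHomeomorph.symm t.target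
  snd_op_smul : ∀ p ∈ t.source, ∀ g : G, (t (op g • p)).2 = (t p).2 * g

namespace IsSmoothEquivariant

variable {t : Bundle.Trivialization G ρ}

lemma eq_one_of_op_smul_eq (ht : IsSmoothEquivariant IP IB IG t) {p : P} (hp : p ∈ t.source)
    {g : G} (hg : op g • p = p) : g = 1 := by
  simpa only [hg, left_eq_mul] using ht.snd_op_smul p hp g

lemma contMDiffAt_proj (ht : IsSmoothEquivariant IP IB IG t) {p : P} (hp : p ∈ t.source) :
    ContMDiffAt IP IB ∞ ρ p := by
  have hsource : t.source ∈ 𝓝 p := t.open_source.mem_nhds hp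
  refine (contMDiffAt_fst.comp p (ht.contMDiffOn.contMDiffAt hsource)).congr_of_eventuallyEq ?_
  filter_upwards [hsource] with q hq
  exact (t.coe_fst hq).symm

variable (hρ : ∀ (p : P) (g : G), ρ (op g • p) = ρ p)
include hρ

lemma apply_op_smul (ht : IsSmoothEquivariant IP IB IG t) {p : P} (hp : p ∈ t.source) (g : G) :
    t (op g • p) = ((t p).1, (t p).2 * g) := by
  have hgp : op g • p ∈ t.source := t.mem_source.2 (hρ p g ▸ t.mem_source.1 hp)
  exact Prod.ext (by rw [t.coe_fst hgp, t.coe_fst hp, hρ]) (ht.snd_op_smul p hp g)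

lemma exists_op_smul_eq (ht : IsSmoothEquivariant IP IB IG t) {p q : P} (hp : p ∈ t.source)
    (hpq : ρ p = ρ q) : ∃ g : G, op g • p = q := by
  have hq : q ∈ t.source := t.mem_source.2 (hpq ▸ t.mem_source.1 hp)
  set g : G := (t p).2⁻¹ * (t q).2
  have hgp : op g • p ∈ t.source := t.mem_source.2 (hρ p g ▸ t.mem_source.1 hp)
  refine ⟨g, t.injOn hgp hq ?_⟩
  change t (op g • p) = t q
  rw [ht.apply_op_smul hρ hp, mul_inv_cancel_left, t.coe_fst hp, hpq, t.mk_proj_snd hq]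

lemma contMDiffAt_op_smul [LieGroup IG ∞ G] (ht : IsSmoothEquivariant IP IB IG t) {p : P}
    (hp : p ∈ t.source) (g : G) :
    ContMDiffAt (IP.prod IG) IP ∞ (fun q : P × G => op q.2 • q.1) (p, g) := by
  have hsource : Prod.fst ⁻¹' t.source ∈ 𝓝 (p, g) :=
    (t.open_source.preimage continuous_fst).mem_nhds hp
  have htarget : ((t p).1, (t p).2 * g) ∈ t.target :=
    t.mem_target.2 (t.coe_fst hp ▸ t.mem_source.1 hp)
  have htfst : ContMDiffAt (IP.prod IG) (IB.prod IG) ∞ (fun q : P × G => t q.1) (p, g) :=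
    (ht.contMDiffOn.contMDiffAt (t.open_source.mem_nhds hp)).comp (p, g) contMDiffAt_fst
  have hmul : ContMDiffAt (IP.prod IG) (IB.prod IG) ∞
      (fun q : P × G => ((t q.1).1, (t q.1).2 * q.2)) (p, g) :=
    htfst.fst.prodMk (htfst.snd.mul contMDiffAt_snd)
  refine ((ht.contMDiffOn_symm.contMDiffAt (t.open_target.mem_nhds htarget)).comp (p, g)
    hmul).congr_of_eventuallyEq ?_
  filter_upwards [hsource] with q hq
  have hgq : op q.2 • q.1 ∈ t.source := t.mem_source.2 (hρ q.1 q.2 ▸ t.mem_source.1 hq)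
  exact ((congrArg t.toOpenPartialHomeomorph.symm (ht.apply_op_smul hρ hq q.2)).symm.trans
    (t.toOpenPartialHomeomorph.left_inv hgq)).symm

end IsSmoothEquivariant

theorem IsSmoothPrincipalBundle.of_trivializations
    [IsManifold IP ∞ P] [IsManifold IB ∞ B] [LieGroup IG ∞ G]
    (hρ : ∀ (p : P) (g : G), ρ (op g • p) = ρ p)
    (h : ∀ b : B, ∃ t : Bundle.Trivialization G ρ, b ∈ t.baseSet ∧ IsSmoothEquivariant IP IB IG t) :
    IsSmoothPrincipalBundle IP IB IG G ρ := by
  have hsource (p : P) : ∃ t : Bundle.Trivialization G ρ,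
      p ∈ t.source ∧ IsSmoothEquivariant IP IB IG t := by
    obtain ⟨t, hp, ht⟩ := h (ρ p)
    exact ⟨t, t.mem_source.2 hp, ht⟩
  refine ⟨?_, ?_, ?_, ?_, ?_, ?_⟩
  · rintro ⟨p, g⟩
    obtain ⟨t, hp, ht⟩ := hsource p
    exact ht.contMDiffAt_op_smul hρ hp g
  · intro p g hg
    obtain ⟨t, hp, ht⟩ := hsource p
    exact ht.eq_one_of_op_smul_eq hp hg
  · refine fun p q => ⟨fun hpq => ?_, ?_⟩
    · obtain ⟨t, hp, ht⟩ := hsource p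
      exact ht.exists_op_smul_eq hρ hp hpq
    · rintro ⟨g, rfl⟩
      exact (hρ p g).symm
  · intro b
    obtain ⟨t, hb, -⟩ := h b
    exact ⟨_, t.proj_symm_apply' (x := 1) hb⟩
  · intro p
    obtain ⟨t, hp, ht⟩ := hsource p
    exact ht.contMDiffAt_proj hp
  · intro b
    obtain ⟨t, hb, ht⟩ := h b
    exact ⟨t, hb, ht.contMDiffOn, ht.contMDiffOn_symm, fun p hp g => ht.apply_op_smul hρ hp g⟩

end PrincipalBundleCriterion

section BlockTriangular

lemma linearIndependent_map_basis_iff {ι R V W : Type*} [Semiring R] [AddCommMonoid V] [Module R V]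
    [AddCommMonoid W] [Module R W] (b : Module.Basis ι R V) (T : V →ₗ[R] W) :
    LinearIndependent R (T ∘ b) ↔ Function.Injective T := by
  rw [LinearIndependent, Finsupp.linearCombination_linear_comp, ← b.coe_repr_symm,
    LinearMap.coe_comp]
  exact EquivLike.injective_comp b.repr.symm T

lemma injective_coprod_inr_comp_iff {K X Y Z : Type*} [DivisionRing K] [AddCommGroup X] [Module K X]
    [AddCommGroup Y] [Module K Y] [FiniteDimensional K Y] [AddCommGroup Z] [Module K Z]
    (h : X →ₗ[K] Z × Y) (v : Y →ₗ[K] Y) :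
    Function.Injective (h.coprod (LinearMap.inr K Z Y ∘ₗ v)) ↔
      Function.Injective (LinearMap.fst K Z Y ∘ₗ h) ∧ Function.Injective v := by
  simp only [injective_iff_map_eq_zero, LinearMap.coprod_apply, LinearMap.comp_apply,
    LinearMap.inr_apply, LinearMap.fst_apply, Prod.forall]
  refine ⟨fun H => ?_, fun ⟨hh, hv⟩ x y hxy => ?_⟩
  · have hv : ∀ y, v y = 0 → y = 0 := fun y hy =>
      congrArg Prod.snd (H 0 y (by rw [map_zero, hy]; simp))
    refine ⟨fun x hx => ?_, hv⟩
    obtain ⟨y, hy⟩ := LinearMap.injective_iff_surjective.1 ((injective_iff_map_eq_zero v).2 hv)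
      (-(h x).2)
    exact congrArg Prod.fst (H x y (Prod.ext (by simp [hx]) (by simp [hy])))
  · have hx : x = 0 := hh x (by simpa using congrArg Prod.fst hxy)
    have hy : y = 0 := hv y (by simpa [hx] using congrArg Prod.snd hxy)
    rw [hx, hy]; rfl

lemma isUnit_iff_injective {𝕜 V : Type*} [NontriviallyNormedField 𝕜] [CompleteSpace 𝕜]
    [NormedAddCommGroup V] [NormedSpace 𝕜 V] [FiniteDimensional 𝕜 V] (f : V →L[𝕜] V) :
    IsUnit f ↔ Function.Injective f := by
  have : CompleteSpace V := FiniteDimensional.complete 𝕜 V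
  rw [ContinuousLinearMap.isUnit_iff_bijective]
  exact ⟨And.left, fun hf => ⟨hf, LinearMap.injective_iff_surjective (f := f.toLinearMap).1 hf⟩⟩

end BlockTriangular

section Columns

variable {d : ℕ} {V : Type*} [NormedAddCommGroup V] [NormedSpace ℝ V]

/-- The matrix with columns `w i`: the linear map `ℝ^d → V` sending `stdVec i` to `w i`. -/
def columns (d : ℕ) (V : Type*) [NormedAddCommGroup V] [NormedSpace ℝ V] :
    (Fin d → V) ≃L[ℝ] (Euc d →L[ℝ] V) :=
  (ContinuousLinearEquiv.piRing (Fin d)).symm.trans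
    ((EuclideanSpace.equiv (Fin d) ℝ).symm.arrowCongr (ContinuousLinearEquiv.refl ℝ V))

lemma columns_apply (w : Fin d → V) (x : Euc d) : columns d V w x = ∑ i, x i • w i :=
  LinearEquiv.piRing_symm_apply ℝ w x.ofLp

lemma columns_stdVec (w : Fin d → V) (j : Fin d) : columns d V w (stdVec j) = w j := by
  simp [columns_apply]

end Columns

section Units

variable {R : Type*} [NormedRing R] [CompleteSpace R]

/-- The partial inverse of the inclusion `Rˣ → R`; its values at non-units are junk. -/
def liftToUnits : R → Rˣ :=
  (Units.isOpenEmbedding_val.toOpenPartialHomeomorph Units.val).symm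

lemma val_liftToUnits {a : R} (ha : IsUnit a) : (liftToUnits a : R) = a :=
  Units.isOpenEmbedding_val.toOpenPartialHomeomorph_right_inv (f := Units.val) ha

lemma contMDiffOn_liftToUnits {𝕜 : Type*} [NontriviallyNormedField 𝕜] [NormedAlgebra 𝕜 R]
    {m : ℕ∞ω} : ContMDiffOn 𝓘(𝕜, R) 𝓘(𝕜, R) m (liftToUnits : R → Rˣ) {a | IsUnit a} :=
  contMDiffOn_isOpenEmbedding_symm Units.isOpenEmbedding_val

end Units

section BlockCoordinates

variable {n k : ℕ}

/-- The model space of `L_π E` with frame coordinates packed into matrices: the columns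
`(v^i_j, v^A_j)` of the vectors `e_j`, then the columns `v^A_B` of the vectors `e_B`. -/
abbrev BlockModel (n k : ℕ) :=
  (Euc n × Euc k) × (Euc n →L[ℝ] Euc n × Euc k) × (Euc k →L[ℝ] Euc k)

/-- The linear change of coordinates which packs frame coordinates into matrices. -/
def toBlocks (n k : ℕ) : FrameModel n k ≃L[ℝ] BlockModel n k :=
  (ContinuousLinearEquiv.refl ℝ _).prodCongr ((columns n _).prodCongr (columns k _))

lemma linearIndependent_family_iff (w : Fin n → Euc n × Euc k) (v : Fin k → Euc k) :
    LinearIndependent ℝ (AdaptedChart.family w v) ↔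
      IsUnit ((ContinuousLinearMap.fst ℝ _ _).comp (columns n _ w)) ∧ IsUnit (columns k _ v) := by
  have hfamily : AdaptedChart.family w v =
      ((columns n _ w).toLinearMap.coprod
        (LinearMap.inr ℝ (Euc n) (Euc k) ∘ₗ (columns k _ v).toLinearMap)) ∘ stdBasis n k := by
    funext i
    rcases i with i | A
    · simp [AdaptedChart.family, stdBasis_inl, columns_stdVec]
    · simp [AdaptedChart.family, stdBasis_inr, columns_stdVec]
  rw [hfamily, linearIndependent_map_basis_iff, injective_coprod_inr_comp_iff,
    isUnit_iff_injective, isUnit_iff_injective]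
  rfl

/-- The jet spanned by the first `n` vectors of a frame: its slope `s` is the solution of
`v^A_j = s^A_i v^i_j`. It is only meaningful if `(v^i_j)` is invertible. -/
def jetOfBlocks (q : BlockModel n k) : JetModel n k :=
  (q.1, ((ContinuousLinearMap.snd ℝ _ _).comp q.2.1).comp
    (Ring.inverse ((ContinuousLinearMap.fst ℝ _ _).comp q.2.1)))

/-- The frame with `(v^i_j) = a` and `(v^A_B) = b` whose first `n` vectors lie in the graph of the
slope of the jet `p`. -/
def blocksOfJet (p : JetModel n k) (a : Euc n →L[ℝ] Euc n) (b : Euc k →L[ℝ] Euc k) :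
    BlockModel n k :=
  (p.1, a.prod (p.2.comp a), b)

lemma jetOfBlocks_blocksOfJet (p : JetModel n k) {a : Euc n →L[ℝ] Euc n} (ha : IsUnit a)
    (b : Euc k →L[ℝ] Euc k) : jetOfBlocks (blocksOfJet p a b) = p := by
  refine Prod.ext rfl ?_
  change p.2.comp (a * Ring.inverse a) = p.2
  rw [Ring.mul_inverse_cancel a ha]
  rfl

lemma contDiffAt_jetOfBlocks {q : BlockModel n k}
    (hq : IsUnit ((ContinuousLinearMap.fst ℝ _ _).comp q.2.1)) : ContDiffAt ℝ ∞ jetOfBlocks q := by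
  have hinv : ContDiffAt ℝ ∞
      (fun q : BlockModel n k =>
        Ring.inverse ((ContinuousLinearMap.fst ℝ (Euc n) (Euc k)).comp q.2.1)) q :=
    (contDiffAt_ringInverse ℝ hq.unit).comp
      (f := fun q : BlockModel n k => (ContinuousLinearMap.fst ℝ _ _).comp q.2.1) q (by fun_prop)
  exact contDiffAt_fst.prodMk (ContDiffAt.clm_comp (by fun_prop) hinv)

lemma contDiff_blocksOfJet :
    ContDiff ℝ ∞ fun r : JetModel n k × (Euc n →L[ℝ] Euc n) × (Euc k →L[ℝ] Euc k) =>
      blocksOfJet r.1 r.2.1 r.2.2 := by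
  have hprod : ContDiff ℝ ∞
      fun r : JetModel n k × (Euc n →L[ℝ] Euc n) × (Euc k →L[ℝ] Euc k) =>
        r.2.1.prod (r.1.2.comp r.2.1) :=
    (ContinuousLinearMap.prodₗᵢ ℝ (𝕜 := ℝ)).contDiff.comp
      (f := fun r : JetModel n k × (Euc n →L[ℝ] Euc n) × (Euc k →L[ℝ] Euc k) =>
        (r.2.1, r.1.2.comp r.2.1)) (by fun_prop)
  unfold blocksOfJet
  fun_prop

end BlockCoordinates

section AdaptedFrameProjection

variable {n k : ℕ} {F E M : Type*}
  [TopologicalSpace F] [ChartedSpace (Euc k) F]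
  [TopologicalSpace E] [ChartedSpace (Euc (n + k)) E]
  [TopologicalSpace M] [ChartedSpace (Euc n) M]
  {π : SmoothFiberBundle n k F E M}

namespace AdaptedChart

/-- The matrix with columns `(v^i_j, v^A_j)`, the coordinates of the vectors `e_j`. -/
def horBlock (c : AdaptedChart π) (u : AdaptedFrame π) : Euc n →L[ℝ] Euc n × Euc k :=
  columns n _ (c.horCoord u)

/-- The matrix with columns `v^A_B`, the coordinates of the vectors `e_B`. -/
def verBlock (c : AdaptedChart π) (u : AdaptedFrame π) : Euc k →L[ℝ] Euc k :=
  columns k _ (c.verCoord u)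

lemma horBlock_apply (c : AdaptedChart π) (u : AdaptedFrame π) (x : Euc n) :
    c.horBlock u x = c.dTotal u.point (frameMap u.basis (x, 0)) := by
  simp [horBlock, columns_apply, frameMap_apply, horCoord]

lemma verBlock_apply (c : AdaptedChart π) (u : AdaptedFrame π) (y : Euc k) :
    c.verBlock u y = (c.dTotal u.point (frameMap u.basis (0, y))).2 := by
  simp [verBlock, columns_apply, frameMap_apply, verCoord, Prod.snd_sum]

lemma horBlock_act (c : AdaptedChart π) (u : AdaptedFrame π) (g : StructureGroup n k) :
    c.horBlock (u.act g) = (c.horBlock u).comp (g.1 : Euc n →L[ℝ] Euc n) := by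
  ext1 x
  have hframe : frameMap (changeBasis u.basis g) (x, 0) =
      frameMap u.basis ((g.1 : Euc n →L[ℝ] Euc n) x, 0) := by
    rw [frameMap_changeBasis, LinearEquiv.trans_apply, blockMap_apply, map_zero]
  rw [ContinuousLinearMap.comp_apply, horBlock_apply, horBlock_apply, ← hframe]
  rfl

lemma verBlock_act (c : AdaptedChart π) (u : AdaptedFrame π) (g : StructureGroup n k) :
    c.verBlock (u.act g) = (c.verBlock u).comp (g.2 : Euc k →L[ℝ] Euc k) := by
  ext1 y
  have hframe : frameMap (changeBasis u.basis g) (0, y) =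
      frameMap u.basis (0, (g.2 : Euc k →L[ℝ] Euc k) y) := by
    rw [frameMap_changeBasis, LinearEquiv.trans_apply, blockMap_apply, map_zero]
  rw [ContinuousLinearMap.comp_apply, verBlock_apply, verBlock_apply, ← hframe]
  rfl

end AdaptedChart

variable [IsManifold (𝓡 k) ∞ F] [IsManifold (𝓡 n) ∞ M]

namespace AdaptedFrame

/-- The map `τ_e` of `ρ(u)`, with values in the tangent space at the base point of `u`. -/
def horizontalLift (u : AdaptedFrame π) :
    TangentSpace (𝓡 n) (π.proj u.point) →L[ℝ] TangentSpace (𝓡 (n + k)) u.point :=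
  (rho u).lift

lemma horizontalLift_tangentMap_basis (u : AdaptedFrame π) (i : Fin n) :
    u.horizontalLift (π.tangentMap u.point (u.basis (Sum.inl i))) = u.basis (Sum.inl i) := by
  rw [← projBasis_apply]
  exact (projBasis u).constr_basis ℝ (fun i => u.basis (Sum.inl i)) i

lemma horizontalLift_tangentMap_frameMap (u : AdaptedFrame π) (x : Euc n) (y : Euc k) :
    u.horizontalLift (π.tangentMap u.point (frameMap u.basis (x, y))) =
      frameMap u.basis (x, 0) := by
  simp [frameMap_apply, u.vertical, horizontalLift_tangentMap_basis]

lemma horizontalLift_tangentMap (u : AdaptedFrame π) (w : TangentSpace (𝓡 (n + k)) u.point) :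
    u.horizontalLift (π.tangentMap u.point w) =
      ∑ i, u.basis.coord (Sum.inl i) w • u.basis (Sum.inl i) := by
  conv_lhs => rw [← u.basis.sum_repr w]
  simp [-Module.Basis.sum_repr, u.vertical, horizontalLift_tangentMap_basis]

end AdaptedFrame

lemma rho_act (u : AdaptedFrame π) (g : StructureGroup n k) : rho (u.act g) = rho u := by
  refine JetBundle.ext_lift (ContinuousLinearMap.ext fun v => ?_)
  obtain ⟨w, rfl⟩ := tangentMap_surjective π u.point v
  obtain ⟨⟨x, y⟩, rfl⟩ := (frameMap (changeBasis u.basis g)).surjective w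
  have hact : (u.act g).horizontalLift (π.tangentMap u.point (frameMap (u.act g).basis (x, y))) =
      frameMap (u.act g).basis (x, 0) := (u.act g).horizontalLift_tangentMap_frameMap x y
  refine hact.trans ?_
  change frameMap (changeBasis u.basis g) (x, 0) =
    u.horizontalLift (π.tangentMap u.point (frameMap (changeBasis u.basis g) (x, y)))
  simp only [frameMap_changeBasis, LinearEquiv.trans_apply, blockMap_apply, map_zero,
    AdaptedFrame.horizontalLift_tangentMap_frameMap]

namespace AdaptedChart

lemma lagrangianCoord_eq_jetCoord_rho (c : AdaptedChart π) (A : Fin k) (j : Fin n)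
    (u : AdaptedFrame π) (hu : u.point ∈ c.total.source) :
    c.lagrangianCoord A j u = c.jetCoord A j (rho u) := by
  have hddx : π.tangentMap u.point (c.ddxTotal u.point j) = c.ddxBase (π.proj u.point) j :=
    c.tangentMap_inverse hu (stdVec j, 0)
  calc c.lagrangianCoord A j u
      = (c.dTotal u.point
          (∑ i, u.basis.coord (Sum.inl i) (c.ddxTotal u.point j) • u.basis (Sum.inl i))).2 A := by
        simp [lagrangianCoord, Prod.snd_sum, mul_comm]
    _ = (c.dTotal u.point (u.horizontalLift (c.ddxBase (π.proj u.point) j))).2 A := by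
        rw [← u.horizontalLift_tangentMap, hddx]

lemma slope_rho_comp_fst_horBlock (c : AdaptedChart π) {u : AdaptedFrame π}
    (hu : u.point ∈ c.total.source) :
    (c.slope (rho u)).comp ((ContinuousLinearMap.fst ℝ _ _).comp (c.horBlock u)) =
      (ContinuousLinearMap.snd ℝ _ _).comp (c.horBlock u) := by
  ext1 x
  have hbase : (c.dBase (π.proj u.point)).inverse (c.horBlock u x).1 =
      π.tangentMap u.point (frameMap u.basis (x, 0)) := by
    rw [horBlock_apply, ← c.dBase_tangentMap hu, c.inverse_dBase (c.mapsTo_proj _ hu)]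
  calc c.slope (rho u) (c.horBlock u x).1
      = (c.dTotal u.point
          (u.horizontalLift ((c.dBase (π.proj u.point)).inverse (c.horBlock u x).1))).2 := rfl
    _ = (c.horBlock u x).2 := by
        rw [hbase, u.horizontalLift_tangentMap_frameMap, horBlock_apply]

end AdaptedChart

end AdaptedFrameProjection

section RhoTrivialization

variable {n k : ℕ} {F E M : Type*}
  [TopologicalSpace F] [ChartedSpace (Euc k) F] [IsManifold (𝓡 k) ∞ F]
  [TopologicalSpace E] [ChartedSpace (Euc (n + k)) E]
  [TopologicalSpace M] [ChartedSpace (Euc n) M] [IsManifold (𝓡 n) ∞ M]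
  {π : SmoothFiberBundle n k F E M}

namespace AdaptedChart

/-- The jet coordinates `(x^i, y^A, y^A_j)` as a chart of the manifold `J¹π`. -/
def jetHomeo (c : AdaptedChart π) : OpenPartialHomeomorph (JetBundle π) (JetModel n k) :=
  (jetCore π).openPartialHomeomorph (jetChart c) (mem_range_self c)

/-- The frame coordinates `(x^i, y^A, v^i_j, v^A_j, v^A_B)`, packed into matrices, as a chart of
the manifold `L_π E`. -/
def blockHomeo (c : AdaptedChart π) : OpenPartialHomeomorph (AdaptedFrame π) (BlockModel n k) :=
  ((frameCore π).openPartialHomeomorph (frameChart c) (mem_range_self c)).transHomeomorph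
    (toBlocks n k).toHomeomorph

lemma blockHomeo_apply (c : AdaptedChart π) (u : AdaptedFrame π) :
    c.blockHomeo u = (c.total u.point, c.horBlock u, c.verBlock u) :=
  rfl

lemma mem_blockHomeo_target {c : AdaptedChart π} {q : BlockModel n k} :
    q ∈ c.blockHomeo.target ↔ q.1 ∈ c.total.target ∧
      IsUnit ((ContinuousLinearMap.fst ℝ _ _).comp q.2.1) ∧ IsUnit q.2.2 := by
  obtain ⟨r, rfl⟩ := (toBlocks n k).surjective q
  have htarget : toBlocks n k r ∈ c.blockHomeo.target ↔ r ∈ (frameChart c).target := by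
    change (toBlocks n k).symm (toBlocks n k r) ∈ (frameChart c).target ↔ _
    rw [ContinuousLinearEquiv.symm_apply_apply]
  rw [htarget]
  exact and_congr_right' (linearIndependent_family_iff r.2.1 r.2.2)

lemma isUnit_fst_comp_horBlock (c : AdaptedChart π) {u : AdaptedFrame π}
    (hu : u.point ∈ c.total.source) :
    IsUnit ((ContinuousLinearMap.fst ℝ _ _).comp (c.horBlock u)) :=
  (mem_blockHomeo_target.1 (c.blockHomeo.map_source hu)).2.1

lemma isUnit_verBlock (c : AdaptedChart π) {u : AdaptedFrame π} (hu : u.point ∈ c.total.source) :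
    IsUnit (c.verBlock u) :=
  (mem_blockHomeo_target.1 (c.blockHomeo.map_source hu)).2.2

lemma jetHomeo_mem_maximalAtlas (c : AdaptedChart π) :
    c.jetHomeo ∈ IsManifold.maximalAtlas 𝓘(ℝ, JetModel n k) ∞ (JetBundle π) :=
  IsManifold.subset_maximalAtlas (mem_iUnion₂.2 ⟨_, mem_range_self c, rfl⟩)

lemma frameChart_mem_maximalAtlas (c : AdaptedChart π) :
    (frameCore π).openPartialHomeomorph (frameChart c) (mem_range_self c) ∈
      IsManifold.maximalAtlas 𝓘(ℝ, FrameModel n k) ∞ (AdaptedFrame π) :=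
  IsManifold.subset_maximalAtlas (mem_iUnion₂.2 ⟨_, mem_range_self c, rfl⟩)

lemma contMDiffOn_jetHomeo (c : AdaptedChart π) :
    ContMDiffOn 𝓘(ℝ, JetModel n k) 𝓘(ℝ, JetModel n k) ∞ c.jetHomeo c.jetHomeo.source :=
  contMDiffOn_of_mem_maximalAtlas c.jetHomeo_mem_maximalAtlas

lemma contMDiffOn_jetHomeo_symm (c : AdaptedChart π) :
    ContMDiffOn 𝓘(ℝ, JetModel n k) 𝓘(ℝ, JetModel n k) ∞ c.jetHomeo.symm c.jetHomeo.target :=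
  contMDiffOn_symm_of_mem_maximalAtlas c.jetHomeo_mem_maximalAtlas

lemma contMDiffOn_blockHomeo (c : AdaptedChart π) :
    ContMDiffOn 𝓘(ℝ, FrameModel n k) 𝓘(ℝ, BlockModel n k) ∞ c.blockHomeo c.blockHomeo.source :=
  (toBlocks n k).contDiff.contMDiff.comp_contMDiffOn
    (contMDiffOn_of_mem_maximalAtlas c.frameChart_mem_maximalAtlas)

lemma contMDiffOn_blockHomeo_symm (c : AdaptedChart π) :
    ContMDiffOn 𝓘(ℝ, BlockModel n k) 𝓘(ℝ, FrameModel n k) ∞ c.blockHomeo.symm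
      c.blockHomeo.target :=
  (contMDiffOn_symm_of_mem_maximalAtlas c.frameChart_mem_maximalAtlas).comp
    (toBlocks n k).symm.contDiff.contMDiff.contMDiffOn fun _ hq => hq

/-- The group component `((v^i_j), (v^A_B))` of the local trivialization of `ρ` given by adapted
coordinates. -/
def gauge (c : AdaptedChart π) (u : AdaptedFrame π) : StructureGroup n k :=
  (liftToUnits ((ContinuousLinearMap.fst ℝ _ _).comp (c.horBlock u)), liftToUnits (c.verBlock u))

lemma coe_gauge_fst (c : AdaptedChart π) {u : AdaptedFrame π} (hu : u.point ∈ c.total.source) :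
    ((c.gauge u).1 : Euc n →L[ℝ] Euc n) =
      (ContinuousLinearMap.fst ℝ _ _).comp (c.horBlock u) :=
  val_liftToUnits (c.isUnit_fst_comp_horBlock hu)

lemma coe_gauge_snd (c : AdaptedChart π) {u : AdaptedFrame π} (hu : u.point ∈ c.total.source) :
    ((c.gauge u).2 : Euc k →L[ℝ] Euc k) = c.verBlock u :=
  val_liftToUnits (c.isUnit_verBlock hu)

lemma gauge_act (c : AdaptedChart π) {u : AdaptedFrame π} (hu : u.point ∈ c.total.source)
    (g : StructureGroup n k) : c.gauge (u.act g) = c.gauge u * g := by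
  have hug : (u.act g).point ∈ c.total.source := hu
  refine Prod.ext (Units.ext ?_) (Units.ext ?_)
  · rw [c.coe_gauge_fst hug, c.horBlock_act, Prod.fst_mul, Units.val_mul, c.coe_gauge_fst hu]
    rfl
  · rw [c.coe_gauge_snd hug, c.verBlock_act, Prod.snd_mul, Units.val_mul, c.coe_gauge_snd hu]
    rfl

lemma contMDiffOn_gauge (c : AdaptedChart π) :
    ContMDiffOn 𝓘(ℝ, FrameModel n k) (𝓘(ℝ, Euc n →L[ℝ] Euc n).prod 𝓘(ℝ, Euc k →L[ℝ] Euc k)) ∞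
      c.gauge c.blockHomeo.source := by
  have hhor : ContDiff ℝ ∞ fun q : BlockModel n k =>
      (ContinuousLinearMap.fst ℝ (Euc n) (Euc k)).comp q.2.1 := by fun_prop
  have hver : ContDiff ℝ ∞ fun q : BlockModel n k => q.2.2 := by fun_prop
  exact (contMDiffOn_liftToUnits.comp (hhor.contMDiff.comp_contMDiffOn c.contMDiffOn_blockHomeo)
    fun _ hu => c.isUnit_fst_comp_horBlock hu).prodMk
      (contMDiffOn_liftToUnits.comp (hver.contMDiff.comp_contMDiffOn c.contMDiffOn_blockHomeo)
        fun _ hu => c.isUnit_verBlock hu)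

lemma blockHomeo_eq_blocksOfJet (c : AdaptedChart π) {u : AdaptedFrame π}
    (hu : u.point ∈ c.total.source) :
    c.blockHomeo u = blocksOfJet (c.jetHomeo (rho u)) (c.gauge u).1 (c.gauge u).2 := by
  rw [c.coe_gauge_fst hu, c.coe_gauge_snd hu]
  refine Prod.ext rfl (Prod.ext ?_ rfl)
  change c.horBlock u = ((ContinuousLinearMap.fst ℝ _ _).comp (c.horBlock u)).prod
    ((c.slope (rho u)).comp ((ContinuousLinearMap.fst ℝ _ _).comp (c.horBlock u)))
  rw [c.slope_rho_comp_fst_horBlock hu]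
  rfl

lemma jetHomeo_rho (c : AdaptedChart π) {u : AdaptedFrame π} (hu : u.point ∈ c.total.source) :
    c.jetHomeo (rho u) = jetOfBlocks (c.blockHomeo u) := by
  rw [c.blockHomeo_eq_blocksOfJet hu, jetOfBlocks_blocksOfJet _ (c.gauge u).1.isUnit]

lemma contMDiffOn_rho (c : AdaptedChart π) :
    ContMDiffOn 𝓘(ℝ, FrameModel n k) 𝓘(ℝ, JetModel n k) ∞
      (rho : AdaptedFrame π → JetBundle π) c.blockHomeo.source := by
  have hmaps : MapsTo rho c.blockHomeo.source c.jetHomeo.source := fun _ hu => hu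
  have hjet : ContMDiffOn 𝓘(ℝ, FrameModel n k) 𝓘(ℝ, JetModel n k) ∞
      (fun u : AdaptedFrame π => c.jetHomeo (rho u)) c.blockHomeo.source := fun u hu =>
    ((contDiffAt_jetOfBlocks (c.isUnit_fst_comp_horBlock hu)).contMDiffAt.comp_contMDiffWithinAt u
      (c.contMDiffOn_blockHomeo u hu)).congr (fun _ hv => c.jetHomeo_rho hv) (c.jetHomeo_rho hu)
  refine (c.contMDiffOn_jetHomeo_symm.comp hjet fun u hu =>
    c.jetHomeo.map_source (hmaps hu)).congr fun u hu => ?_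
  exact (c.jetHomeo.left_inv (hmaps hu)).symm

/-- The adapted frame with prescribed projection to `J¹π` and prescribed `gauge`. -/
def glue (c : AdaptedChart π) (r : JetBundle π × StructureGroup n k) : AdaptedFrame π :=
  c.blockHomeo.symm (blocksOfJet (c.jetHomeo r.1) r.2.1 r.2.2)

lemma blocksOfJet_mem_target (c : AdaptedChart π) {τ : JetBundle π}
    (hτ : τ.point ∈ c.total.source) (g : StructureGroup n k) :
    blocksOfJet (c.jetHomeo τ) g.1 g.2 ∈ c.blockHomeo.target :=
  mem_blockHomeo_target.2 ⟨c.total.map_source hτ, g.1.isUnit, g.2.isUnit⟩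

lemma glue_point_mem_source (c : AdaptedChart π) {τ : JetBundle π} (hτ : τ.point ∈ c.total.source)
    (g : StructureGroup n k) : (c.glue (τ, g)).point ∈ c.total.source :=
  c.blockHomeo.map_target (c.blocksOfJet_mem_target hτ g)

lemma blockHomeo_glue (c : AdaptedChart π) {τ : JetBundle π} (hτ : τ.point ∈ c.total.source)
    (g : StructureGroup n k) :
    c.blockHomeo (c.glue (τ, g)) = blocksOfJet (c.jetHomeo τ) g.1 g.2 :=
  c.blockHomeo.right_inv (c.blocksOfJet_mem_target hτ g)

lemma rho_glue (c : AdaptedChart π) {τ : JetBundle π} (hτ : τ.point ∈ c.total.source)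
    (g : StructureGroup n k) : rho (c.glue (τ, g)) = τ := by
  have hglue := c.glue_point_mem_source hτ g
  refine c.jetHomeo.injOn hglue hτ ?_
  rw [c.jetHomeo_rho hglue, c.blockHomeo_glue hτ, jetOfBlocks_blocksOfJet _ g.1.isUnit]

lemma gauge_glue (c : AdaptedChart π) {τ : JetBundle π} (hτ : τ.point ∈ c.total.source)
    (g : StructureGroup n k) : c.gauge (c.glue (τ, g)) = g := by
  have hglue := c.glue_point_mem_source hτ g
  have hblocks := (c.blockHomeo_apply _).symm.trans (c.blockHomeo_glue hτ g)
  refine Prod.ext (Units.ext ?_) (Units.ext ?_)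
  · rw [c.coe_gauge_fst hglue]
    exact congrArg (fun q : BlockModel n k => (ContinuousLinearMap.fst ℝ _ _).comp q.2.1) hblocks
  · rw [c.coe_gauge_snd hglue]
    exact congrArg (fun q : BlockModel n k => q.2.2) hblocks

lemma glue_rho_gauge (c : AdaptedChart π) {u : AdaptedFrame π} (hu : u.point ∈ c.total.source) :
    c.glue (rho u, c.gauge u) = u := by
  rw [glue, ← c.blockHomeo_eq_blocksOfJet hu]
  exact c.blockHomeo.left_inv hu

lemma contMDiffOn_glue (c : AdaptedChart π) :
    ContMDiffOn
      (𝓘(ℝ, JetModel n k).prod (𝓘(ℝ, Euc n →L[ℝ] Euc n).prod 𝓘(ℝ, Euc k →L[ℝ] Euc k)))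
      𝓘(ℝ, FrameModel n k) ∞ c.glue (c.jetHomeo.source ×ˢ univ) := by
  have hjet : ContMDiffOn
      (𝓘(ℝ, JetModel n k).prod (𝓘(ℝ, Euc n →L[ℝ] Euc n).prod 𝓘(ℝ, Euc k →L[ℝ] Euc k)))
      𝓘(ℝ, JetModel n k) ∞ (fun r : JetBundle π × StructureGroup n k => c.jetHomeo r.1)
      (c.jetHomeo.source ×ˢ univ) :=
    c.contMDiffOn_jetHomeo.comp contMDiff_fst.contMDiffOn fun _ hr => hr.1
  have hval : ContMDiff (𝓘(ℝ, Euc n →L[ℝ] Euc n).prod 𝓘(ℝ, Euc k →L[ℝ] Euc k))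
      𝓘(ℝ, (Euc n →L[ℝ] Euc n) × (Euc k →L[ℝ] Euc k)) ∞
      fun g : StructureGroup n k => ((g.1 : Euc n →L[ℝ] Euc n), (g.2 : Euc k →L[ℝ] Euc k)) :=
    (Units.contMDiff_val.comp contMDiff_fst).prodMk_space (Units.contMDiff_val.comp contMDiff_snd)
  exact c.contMDiffOn_blockHomeo_symm.comp
    (contDiff_blocksOfJet.contMDiff.comp_contMDiffOn
      (hjet.prodMk_space (hval.comp contMDiff_snd).contMDiffOn))
    fun r hr => c.blocksOfJet_mem_target hr.1 r.2

lemma contMDiffOn_rho_gauge (c : AdaptedChart π) :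
    ContMDiffOn 𝓘(ℝ, FrameModel n k)
      (𝓘(ℝ, JetModel n k).prod (𝓘(ℝ, Euc n →L[ℝ] Euc n).prod 𝓘(ℝ, Euc k →L[ℝ] Euc k))) ∞
      (fun u : AdaptedFrame π => (rho u, c.gauge u)) c.blockHomeo.source :=
  c.contMDiffOn_rho.prodMk c.contMDiffOn_gauge

/-- The trivialization of `ρ` over the domain of the jet coordinates induced by `c`. -/
def rhoTrivialization (c : AdaptedChart π) :
    Bundle.Trivialization (StructureGroup n k) (rho : AdaptedFrame π → JetBundle π) where
  toFun u := (rho u, c.gauge u)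
  invFun := c.glue
  source := c.blockHomeo.source
  target := c.jetHomeo.source ×ˢ univ
  map_source' _ hu := ⟨hu, mem_univ _⟩
  map_target' r hr := c.glue_point_mem_source hr.1 r.2
  left_inv' _ hu := c.glue_rho_gauge hu
  right_inv' r hr := Prod.ext (c.rho_glue hr.1 r.2) (c.gauge_glue hr.1 r.2)
  open_source := c.blockHomeo.open_source
  open_target := c.jetHomeo.open_source.prod isOpen_univ
  continuousOn_toFun := c.contMDiffOn_rho_gauge.continuousOn
  continuousOn_invFun := c.contMDiffOn_glue.continuousOn
  baseSet := c.jetHomeo.source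
  open_baseSet := c.jetHomeo.open_source
  source_eq := rfl
  target_eq := rfl
  proj_toFun _ _ := rfl

lemma isSmoothEquivariant_rhoTrivialization (c : AdaptedChart π) :
    IsSmoothEquivariant 𝓘(ℝ, FrameModel n k) 𝓘(ℝ, JetModel n k)
      (𝓘(ℝ, Euc n →L[ℝ] Euc n).prod 𝓘(ℝ, Euc k →L[ℝ] Euc k)) c.rhoTrivialization where
  contMDiffOn := c.contMDiffOn_rho_gauge
  contMDiffOn_symm := c.contMDiffOn_glue
  snd_op_smul _ hu g := c.gauge_act hu g

end AdaptedChart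

theorem isSmoothPrincipalBundle_rho :
    IsSmoothPrincipalBundle 𝓘(ℝ, FrameModel n k) 𝓘(ℝ, JetModel n k)
      (𝓘(ℝ, Euc n →L[ℝ] Euc n).prod 𝓘(ℝ, Euc k →L[ℝ] Euc k))
      (StructureGroup n k) (rho : AdaptedFrame π → JetBundle π) :=
  .of_trivializations rho_act fun τ =>
    ⟨(adaptedChartAt π τ.point).rhoTrivialization, mem_adaptedChartAt π τ.point,
      (adaptedChartAt π τ.point).isSmoothEquivariant_rhoTrivialization⟩

end RhoTrivialization

end JetFrame

end

theorem mainTheorem2 {n k : ℕ} {F E M : Type*}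
    [TopologicalSpace F] [ChartedSpace (Euc k) F] [IsManifold (𝓡 k) ∞ F]
    [TopologicalSpace E] [ChartedSpace (Euc (n + k)) E] [IsManifold (𝓡 (n + k)) ∞ E]
    [TopologicalSpace M] [ChartedSpace (Euc n) M] [IsManifold (𝓡 n) ∞ M]
    (π : SmoothFiberBundle n k F E M) :
    IsSmoothPrincipalBundle 𝓘(ℝ, FrameModel n k) 𝓘(ℝ, JetModel n k)
      (𝓘(ℝ, Euc n →L[ℝ] Euc n).prod 𝓘(ℝ, Euc k →L[ℝ] Euc k))
      (StructureGroup n k) (rho : AdaptedFrame π → JetBundle π) ∧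
    (∀ u : AdaptedFrame π,
      ∃ (τ : TangentSpace (𝓡 n) (π.proj u.point) →L[ℝ] TangentSpace (𝓡 (n + k)) u.point)
        (h : (π.tangentMap u.point).comp τ = ContinuousLinearMap.id ℝ _),
        rho u = ⟨u.point, τ, h⟩ ∧
        ∀ i : Fin n, τ (π.tangentMap u.point (u.basis (Sum.inl i))) = u.basis (Sum.inl i)) ∧
    (∀ (c : AdaptedChart π) (A : Fin k) (j : Fin n) (u : AdaptedFrame π),
      u.point ∈ c.total.source → c.lagrangianCoord A j u = c.jetCoord A j (rho u)) := by
  refine ⟨isSmoothPrincipalBundle_rho, fun u => ?_, fun c A j u hu =>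
    c.lagrangianCoord_eq_jetCoord_rho A j u hu⟩
  exact ⟨u.horizontalLift, (rho u).tangentMap_comp_lift, rfl, u.horizontalLift_tangentMap_basis⟩
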